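/- All algebras are complex, not necessarily associative or unital, and a product that is not listed in a multiplication table (on the basis $e_1,e_2,e_3$) is zero. An algebra $(\mathbf A,\cdot)$ is a *Kokoris algebra* if it is flexible, i.e. $(x\cdot y)\cdot x = x\cdot (y\cdot x)$ for all $x,y$, and the algebra $\mathbf A^+=(\mathbf A,\circ)$ with $x\circ y=\tfrac12(x\cdot y+y\cdot x)$ is associative. Consider the following $3$-dimensional algebras, where $\alpha\in\mathbb C$. (C) Commutative multiplication tables (only one of $e_ie_j=e_je_i$ is written): - $\mathbf A_{00}$: zero product; - $\mathbf A_{01}$: $e_1e_1=e_2$; - $\mathbf A_{02}^{0}$: $e_1e_2=e_3$; - $\mathbf A_{03}$: $e_1e_1=e_2,\ e_1e_2=e_3$; - $\mathbf A_{04}$: $e_1e_1=e_1,\ e_2e_2=e_2,\ e_3e_3=e_3$; - $\mathbf A_{05}$: $e_1e_1=e_1,\ e_2e_2=e_2,\ e_2e_3=e_3$; - $\mathbf A_{06}$: $e_1e_1=e_1,\ e_1e_2=e_2,\ e_1e_3=e_3$; - $\mathbf A_{07}$: $e_1e_1=e_1,\ e_1e_2=e_2,\ e_1e_3=e_3,\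 e_2e_2=e_3$; - $\mathbf A_{08}$: $e_1e_1=e_1,\ e_2e_2=e_2$; - $\mathbf A_{09}$: $e_1e_1=e_1,\ e_1e_2=e_2$; - $\mathbf A_{10}$: $e_1e_1=e_1$; - $\mathbf A_{11}$: $e_1e_1=e_1,\ e_2e_2=e_3$. (A) Anticommutative multiplication tables (only one of $e_ie_j=-e_je_i$ is written): $\mathbf A_{00}$ and - $\mathbf A_{20}$: $e_2e_3=e_1$; - $\mathbf A_{21}$: $e_1e_3=e_1,\ e_2e_3=e_2$; - $\mathbf A_{22}^{\alpha}$: $e_1e_3=e_1+e_2,\ e_2e_3=\alpha e_2$; - $\mathbf A_{23}$: $e_1e_2=e_3,\ e_1e_3=-e_2,\ e_2e_3=e_1$; - $\mathbf A_{24}^{\alpha}$: $e_1e_2=e_3,\ e_1e_3=e_1+e_3,\ e_2e_3=\alpha e_2$; - $\mathbf A_{25}$: $e_1e_2=e_1,\ e_2e_3=e_2$; - $\mathbf A_{26}$: $e_1e_2=e_3,\ e_1e_3=e_1,\ e_2e_3=e_2$. (K) The remaining algebras: - $\mathbf A_{02}^{\alpha}$ with $\alpha\neq 0$: $e_1e_2=(1+\alpha)e_3,\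 e_2e_1=(1-\alpha)e_3$; - $\mathbf A_{27}$: $e_1e_1=e_2,\ e_1e_3=e_3,\ e_3e_1=-e_3$; - $\mathbf A_{28}$: $e_1e_1=e_2,\ e_1e_3=e_2,\ e_3e_1=-e_2$; - $\mathbf A_{29}$: $e_1e_1=e_1,\ e_1e_2=e_2e_1=e_2,\ e_1e_3=e_3e_1=e_3,\ e_2e_3=e_3,\ e_3e_2=-e_3$; - $\mathbf A_{30}$: $e_1e_1=e_1,\ e_2e_3=e_3,\ e_3e_2=-e_3$. **Theorem.** All algebras listed in (C), (A), (K) are $3$-dimensional Kokoris algebras. Conversely, let $\mathbf K$ be a complex $3$-dimensional Kokoris algebra. Then $\mathbf K$ is an associative commutative algebra isomorphic to one of the algebras in (C), or an anticommutative algebra isomorphic to one of the algebras in (A), or $\mathbf K$ is isomorphic to one of the algebras in (K). Two algebras of the whole list with different names are isomorphic only in the following cases, in which they are indeed isomorphic: $\mathbf A_{02}^{\alpha}\cong\mathbf A_{02}^{-\alpha}$ for all $\alpha$, and $\mathbf A_{22}^{\alpha}\cong\mathbf A_{22}^{\alpha^{-1}}$, $\mathbf A_{24}^{\alpha}\cong\mathbf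 A_{24}^{\alpha^{-1}}$ for $\alpha\neq0$. -/

import Mathlib

/-- The product `x ∘ y = ½ (x y + y x)` of the algebra `A⁺`. -/
noncomputable def plusMul {A : Type*} [NonUnitalNonAssocRing A] [Module ℂ A] (x y : A) : A :=
  (1 / 2 : ℂ) • (x * y + y * x)

/-- A complex (not necessarily associative or unital) algebra `A` is a Kokoris algebra if it is
flexible, i.e. `(x, y, x) = (x y) x - x (y x) = 0`, and `A⁺` is associative. -/
structure IsKokoris (A : Type*) [NonUnitalNonAssocRing A] [Module ℂ A] : Prop where
  flexible : ∀ x y : A, associator x y x = 0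
  plus_assoc : ∀ x y z : A, plusMul (plusMul x y) z = plusMul x (plusMul y z)

/-- The complex algebras `A` and `B` are isomorphic: there is a bijective `ℂ`-linear map
preserving products. -/
def AlgIso (A B : Type*) [NonUnitalNonAssocRing A] [Module ℂ A]
    [NonUnitalNonAssocRing B] [Module ℂ B] : Prop :=
  ∃ f : A →ₙₐ[ℂ] B, Function.Bijective f

/-- A multiplication table on the basis `e₁, e₂, e₃` of `ℂ³`:
the entry in row `i` and column `j` is the product `eᵢ eⱼ`. -/
abbrev MulTable : Type := Matrix (Fin 3) (Fin 3) (Fin 3 → ℂ)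

/-- The complex vector space `ℂ³` with the bilinear product given by a multiplication table. -/
def TableAlgebra (_t : MulTable) : Type := Fin 3 → ℂ

namespace TableAlgebra

noncomputable instance (t : MulTable) : AddCommGroup (TableAlgebra t) :=
  inferInstanceAs (AddCommGroup (Fin 3 → ℂ))

noncomputable instance (t : MulTable) : Module ℂ (TableAlgebra t) :=
  inferInstanceAs (Module ℂ (Fin 3 → ℂ))

/-- The coordinates of an element with respect to `e₁, e₂, e₃`. -/
def coord {t : MulTable} (x : TableAlgebra t) : Fin 3 → ℂ := x

/-- The element with given coordinates with respect to `e₁, e₂, e₃`. -/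
def ofCoord (t : MulTable) (v : Fin 3 → ℂ) : TableAlgebra t := v

theorem ext_coord {t : MulTable} {x y : TableAlgebra t} (h : ∀ k, x.coord k = y.coord k) :
    x = y := funext h

theorem add_coord {t : MulTable} (x y : TableAlgebra t) (k : Fin 3) :
    (x + y).coord k = x.coord k + y.coord k := rfl

theorem smul_coord {t : MulTable} (c : ℂ) (x : TableAlgebra t) (k : Fin 3) :
    (c • x).coord k = c * x.coord k := rfl

theorem zero_coord {t : MulTable} (k : Fin 3) : (0 : TableAlgebra t).coord k = 0 := rfl

/-- The bilinear product `(∑ xᵢ eᵢ) (∑ yⱼ eⱼ) = ∑ xᵢ yⱼ (eᵢ eⱼ)`. -/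
noncomputable def product {t : MulTable} (x y : TableAlgebra t) : TableAlgebra t :=
  ofCoord t (∑ i, ∑ j, (x.coord i * y.coord j) • t i j)

theorem product_coord {t : MulTable} (x y : TableAlgebra t) (k : Fin 3) :
    (product x y).coord k = ∑ i, ∑ j, x.coord i * y.coord j * t i j k := by
  change (∑ i, ∑ j, (x.coord i * y.coord j) • t i j) k = _
  simp [Finset.sum_apply]

noncomputable instance (t : MulTable) : NonUnitalNonAssocRing (TableAlgebra t) where
  mul := product
  left_distrib x y z := ext_coord fun k => by
    change (product x (y + z)).coord k = (product x y + product x z).coord k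
    simp only [product_coord, add_coord, ← Finset.sum_add_distrib]
    exact Finset.sum_congr rfl fun i _ => Finset.sum_congr rfl fun j _ => by ring
  right_distrib x y z := ext_coord fun k => by
    change (product (x + y) z).coord k = (product x z + product y z).coord k
    simp only [product_coord, add_coord, ← Finset.sum_add_distrib]
    exact Finset.sum_congr rfl fun i _ => Finset.sum_congr rfl fun j _ => by ring
  zero_mul x := ext_coord fun k => by
    change (product 0 x).coord k = _
    simp [product_coord, zero_coord]
  mul_zero x := ext_coord fun k => by
    change (product x 0).coord k = _
    simp [product_coord, zero_coord]

theorem mul_coord {t : MulTable} (x y : TableAlgebra t) (k : Fin 3) :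
    (x * y).coord k = ∑ i, ∑ j, x.coord i * y.coord j * t i j k :=
  product_coord x y k

instance (t : MulTable) : IsScalarTower ℂ (TableAlgebra t) (TableAlgebra t) :=
  ⟨fun c x y => ext_coord fun k => by
    simp only [smul_eq_mul, mul_coord, smul_coord, Finset.mul_sum]
    exact Finset.sum_congr rfl fun i _ => Finset.sum_congr rfl fun j _ => by ring⟩

instance (t : MulTable) : SMulCommClass ℂ (TableAlgebra t) (TableAlgebra t) :=
  ⟨fun c x y => ext_coord fun k => by
    simp only [smul_eq_mul, mul_coord, smul_coord, Finset.mul_sum]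
    exact Finset.sum_congr rfl fun i _ => Finset.sum_congr rfl fun j _ => by ring⟩

end TableAlgebra

namespace Kokoris

/-- The names of the algebras in the list; `A00` is the algebra with zero product. -/
inductive Name : Type
  | A00
  | A01
  | A02 (α : ℂ)
  | A03
  | A04
  | A05
  | A06
  | A07
  | A08
  | A09
  | A10
  | A11
  | A20
  | A21
  | A22 (α : ℂ)
  | A23
  | A24 (α : ℂ)
  | A25
  | A26
  | A27
  | A28
  | A29
  | A30

/-- The first basis vector of `ℂ³`. -/
def e₁ : Fin 3 → ℂ := ![1, 0, 0]
/-- The second basis vector of `ℂ³`. -/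
def e₂ : Fin 3 → ℂ := ![0, 1, 0]
/-- The third basis vector of `ℂ³`. -/
def e₃ : Fin 3 → ℂ := ![0, 0, 1]

/-- The multiplication tables of the algebras in the list. -/
noncomputable def table : Name → MulTable
  | .A00 => !![0, 0, 0;
               0, 0, 0;
               0, 0, 0]
  | .A01 => !![e₂, 0, 0;
               0, 0, 0;
               0, 0, 0]
  | .A02 α => !![0, (1 + α) • e₃, 0;
                 (1 - α) • e₃, 0, 0;
                 0, 0, 0]
  | .A03 => !![e₂, e₃, 0;
               e₃, 0, 0;
               0, 0, 0]
  | .A04 => !![e₁, 0, 0;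
               0, e₂, 0;
               0, 0, e₃]
  | .A05 => !![e₁, 0, 0;
               0, e₂, e₃;
               0, e₃, 0]
  | .A06 => !![e₁, e₂, e₃;
               e₂, 0, 0;
               e₃, 0, 0]
  | .A07 => !![e₁, e₂, e₃;
               e₂, e₃, 0;
               e₃, 0, 0]
  | .A08 => !![e₁, 0, 0;
               0, e₂, 0;
               0, 0, 0]
  | .A09 => !![e₁, e₂, 0;
               e₂, 0, 0;
               0, 0, 0]
  | .A10 => !![e₁, 0, 0;
               0, 0, 0;
               0, 0, 0]
  | .A11 => !![e₁, 0, 0;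
               0, e₃, 0;
               0, 0, 0]
  | .A20 => !![0, 0, 0;
               0, 0, e₁;
               0, -e₁, 0]
  | .A21 => !![0, 0, e₁;
               0, 0, e₂;
               -e₁, -e₂, 0]
  | .A22 α => !![0, 0, e₁ + e₂;
                 0, 0, α • e₂;
                 -(e₁ + e₂), -(α • e₂), 0]
  | .A23 => !![0, e₃, -e₂;
               -e₃, 0, e₁;
               e₂, -e₁, 0]
  | .A24 α => !![0, e₃, e₁ + e₃;
                 -e₃, 0, α • e₂;
                 -(e₁ + e₃), -(α • e₂), 0]
  | .A25 => !![0, e₁, 0;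
               -e₁, 0, e₂;
               0, -e₂, 0]
  | .A26 => !![0, e₃, e₁;
               -e₃, 0, e₂;
               -e₁, -e₂, 0]
  | .A27 => !![e₂, 0, e₃;
               0, 0, 0;
               -e₃, 0, 0]
  | .A28 => !![e₂, 0, e₂;
               0, 0, 0;
               -e₂, 0, 0]
  | .A29 => !![e₁, e₂, e₃;
               e₂, 0, e₃;
               e₃, -e₃, 0]
  | .A30 => !![e₁, 0, 0;
               0, 0, e₃;
               0, -e₃, 0]

/-- The algebra with a given name. -/
abbrev Alg (N : Name) : Type := TableAlgebra (table N)

/-- The list of associative commutative algebras. -/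
def commutativeList : Set Name :=
  {.A00, .A01, .A02 0, .A03, .A04, .A05, .A06, .A07, .A08, .A09, .A10, .A11}

/-- The list of anticommutative algebras. -/
def anticommutativeList : Set Name :=
  {.A00, .A20, .A21, .A23, .A25, .A26} ∪ Set.range Name.A22 ∪ Set.range Name.A24

/-- The list of the remaining algebras. -/
def properList : Set Name :=
  {N | ∃ α : ℂ, α ≠ 0 ∧ N = .A02 α} ∪ {.A27, .A28, .A29, .A30}

end Kokoris

/-! ### Isomorphisms with table algebras -/

section Iso

variable {A B C : Type*} [NonUnitalNonAssocRing A] [Module ℂ A] [NonUnitalNonAssocRing B]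
  [Module ℂ B] [NonUnitalNonAssocRing C] [Module ℂ C]

/-! In a flexible algebra the commutator obeys the Leibniz rule over the symmetrized product
(`commutator_symm_mul`), and every product is half the sum of anticommutator and commutator. A
Kokoris algebra is therefore a commutative associative algebra A⁺ together with a skew-symmetric
biderivation, on which no Jacobi identity is imposed. So it suffices to list the possible A⁺ in
dimension three and to solve the Leibniz rule on each. For A⁺ (`exists_commutativeList`): a
non-nilpotent element yields an idempotent, whose annihilator and multiples are subalgebras of
smaller dimension unless the algebra is local; a local one is its unit plus a two-dimensional
nilpotent ideal. If everything is nilpotent, either some cube is nonzero, or polarization kills all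
triple products and the multiplication reduces to a symmetric bilinear form. For the biderivations:
basis idempotents commute with everything, because a commutator with an idempotent e would lie in
the ½-eigenspace of e∘, which is zero. Powers of one element also commute with each other. Nonzero
commutators survive only over the tables `A01`, `A02 0`, `A06`, `A10`, which produce the proper
list, and over the zero product, which leaves an arbitrary anticommutative algebra. An
anticommutative product on ℂ³ is xy = M(x × y) for a 3 × 3 matrix M, and change of basis acts on M
by congruence up to a scalar (`algIso_iff_projCongr`). Normal forms come from the position of the
kernel of the skew part of M (`isListed`). To separate the list, the ranks in the pencil M − tMᵀ are
used for the anticommutative part (`anticommutative_algIso`). Elsewhere a decision tree of algebraic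
properties suffices, together with the ratio of commutator to anticommutator, which recovers α up to
sign in `A02 α`. -/

theorem AlgIso.refl (A : Type*) [NonUnitalNonAssocRing A] [Module ℂ A] : AlgIso A A :=
  ⟨NonUnitalAlgHom.id ℂ A, Function.bijective_id⟩

theorem AlgIso.trans (h : AlgIso A B) (h' : AlgIso B C) : AlgIso A C := by
  obtain ⟨f, hf⟩ := h
  obtain ⟨g, hg⟩ := h'
  exact ⟨g.comp f, by simpa using hg.comp hf⟩

theorem AlgIso.symm (h : AlgIso A B) : AlgIso B A := by
  obtain ⟨f, hf⟩ := h
  obtain ⟨g, h1, h2⟩ := Function.bijective_iff_has_inverse.1 hf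
  exact ⟨f.inverse g h1 h2, Function.bijective_iff_has_inverse.2 ⟨f, h2, h1⟩⟩

end Iso

namespace TableAlgebra

/-- The table algebra is `ℂ³` as a vector space. -/
noncomputable def equivFun (t : MulTable) : TableAlgebra t ≃ₗ[ℂ] (Fin 3 → ℂ) :=
  LinearEquiv.refl ℂ (Fin 3 → ℂ)

theorem finrank_eq (t : MulTable) : Module.finrank ℂ (TableAlgebra t) = 3 := by
  rw [(equivFun t).finrank_eq]; simp

/-- The standard basis of a table algebra. -/
noncomputable def basis (t : MulTable) : Module.Basis (Fin 3) ℂ (TableAlgebra t) :=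
  Module.Basis.ofEquivFun (equivFun t)

theorem basis_coord (t : MulTable) (i k : Fin 3) :
    (basis t i).coord k = if k = i then 1 else 0 := by
  have h : basis t i = ofCoord t (Pi.single i 1) := by
    rw [basis, Module.Basis.coe_ofEquivFun]; rfl
  rw [h]
  exact Pi.single_apply i (1 : ℂ) k

theorem basis_mul (t : MulTable) (i j : Fin 3) :
    basis t i * basis t j = ofCoord t (t i j) := by
  refine ext_coord fun k => ?_
  simp only [mul_coord, basis_coord, ite_mul, mul_ite, one_mul, mul_one, zero_mul, mul_zero,
    Finset.sum_ite_eq', Finset.mem_univ, if_true]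
  rfl

theorem sum_smul_basis (t : MulTable) (v : Fin 3 → ℂ) :
    ∑ k, v k • basis t k = ofCoord t v :=
  (basis t).sum_equivFun (ofCoord t v)

theorem basis_mul_eq_sum (t : MulTable) (i j : Fin 3) :
    basis t i * basis t j = ∑ k, t i j k • basis t k := by
  rw [basis_mul, sum_smul_basis]

end TableAlgebra

section Basis

variable {K : Type*} [NonUnitalNonAssocRing K] [Module ℂ K] [IsScalarTower ℂ K K]
  [SMulCommClass ℂ K K]

/-- Both sides of multiplicativity are bilinear, so pairs of basis vectors suffice. -/
theorem algIso_of_linearEquiv {L : Type*} [NonUnitalNonAssocRing L] [Module ℂ L]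
    [IsScalarTower ℂ L L] [SMulCommClass ℂ L L] (b : Module.Basis (Fin 3) ℂ K) (f : K ≃ₗ[ℂ] L)
    (h : ∀ i j, f (b i * b j) = f (b i) * f (b j)) : AlgIso K L := by
  have key : (LinearMap.mul ℂ K).compr₂ f.toLinearMap =
      (LinearMap.mul ℂ L).compl₁₂ f.toLinearMap f.toLinearMap := by
    refine b.ext fun i => b.ext fun j => ?_
    simpa using h i j
  refine ⟨{ toFun := f, map_smul' := f.map_smul, map_zero' := f.map_zero, map_add' := f.map_add,
            map_mul' := fun x y => ?_ }, f.bijective⟩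
  simpa using LinearMap.congr_fun (LinearMap.congr_fun key x) y

theorem algIso_of_basis (t : MulTable) (b : Module.Basis (Fin 3) ℂ K)
    (h : ∀ i j, b i * b j = ∑ k, t i j k • b k) : AlgIso K (TableAlgebra t) := by
  refine algIso_of_linearEquiv b (b.equiv (TableAlgebra.basis t) (Equiv.refl _)) fun i j => ?_
  simp [h, TableAlgebra.basis_mul_eq_sum]

omit [IsScalarTower ℂ K K] [SMulCommClass ℂ K K] in
theorem exists_basis_of_algIso {t : MulTable} (h : AlgIso K (TableAlgebra t)) :
    ∃ b : Module.Basis (Fin 3) ℂ K, ∀ i j, b i * b j = ∑ k, t i j k • b k := by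
  obtain ⟨f, hf⟩ := h.symm
  let e : TableAlgebra t ≃ₗ[ℂ] K := LinearEquiv.ofBijective
    { toFun := f, map_add' := map_add f, map_smul' := map_smul f } hf
  have he : ∀ x, e x = f x := fun _ => rfl
  refine ⟨(TableAlgebra.basis t).map e, fun i j => ?_⟩
  simp only [Module.Basis.map_apply, he, ← map_mul, TableAlgebra.basis_mul_eq_sum, map_sum,
    map_smul]

/-- A linearly independent triple with prescribed products gives an isomorphism. -/
theorem algIso_of_triple (hK : Module.finrank ℂ K = 3) (t : MulTable) {x y z : K}
    (hli : ∀ a b c : ℂ, a • x + b • y + c • z = 0 → a = 0 ∧ b = 0 ∧ c = 0)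
    (hxx : x * x = t 0 0 0 • x + t 0 0 1 • y + t 0 0 2 • z)
    (hxy : x * y = t 0 1 0 • x + t 0 1 1 • y + t 0 1 2 • z)
    (hxz : x * z = t 0 2 0 • x + t 0 2 1 • y + t 0 2 2 • z)
    (hyx : y * x = t 1 0 0 • x + t 1 0 1 • y + t 1 0 2 • z)
    (hyy : y * y = t 1 1 0 • x + t 1 1 1 • y + t 1 1 2 • z)
    (hyz : y * z = t 1 2 0 • x + t 1 2 1 • y + t 1 2 2 • z)
    (hzx : z * x = t 2 0 0 • x + t 2 0 1 • y + t 2 0 2 • z)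
    (hzy : z * y = t 2 1 0 • x + t 2 1 1 • y + t 2 1 2 • z)
    (hzz : z * z = t 2 2 0 • x + t 2 2 1 • y + t 2 2 2 • z) :
    AlgIso K (TableAlgebra t) := by
  have hl : LinearIndependent ℂ ![x, y, z] := by
    rw [Fintype.linearIndependent_iff]
    intro g hg
    have := hli (g 0) (g 1) (g 2) (by simpa [Fin.sum_univ_three] using hg)
    intro i
    fin_cases i
    exacts [this.1, this.2.1, this.2.2]
  let b := basisOfLinearIndependentOfCardEqFinrank hl (by simp [hK])
  have hb : ⇑b = ![x, y, z] := coe_basisOfLinearIndependentOfCardEqFinrank _ _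
  refine algIso_of_basis t b fun i j => ?_
  simp only [hb, Fin.sum_univ_three]
  fin_cases i <;> fin_cases j <;> assumption

end Basis

/-! ### The algebras of the list are Kokoris algebras -/

theorem TableAlgebra.sub_coord {t : MulTable} (x y : TableAlgebra t) (k : Fin 3) :
    (x - y).coord k = x.coord k - y.coord k := rfl

namespace Kokoris

open TableAlgebra

/-- The coordinates of the product of two vectors in the algebra with a given name. -/
noncomputable def mulVec : Name → (Fin 3 → ℂ) → (Fin 3 → ℂ) → Fin 3 → ℂ
  | .A00, _, _ => ![0, 0, 0]
  | .A01, x, y => ![0, x 0 * y 0, 0]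
  | .A02 α, x, y => ![0, 0, (1 + α) * (x 0 * y 1) + (1 - α) * (x 1 * y 0)]
  | .A03, x, y => ![0, x 0 * y 0, x 0 * y 1 + x 1 * y 0]
  | .A04, x, y => ![x 0 * y 0, x 1 * y 1, x 2 * y 2]
  | .A05, x, y => ![x 0 * y 0, x 1 * y 1, x 1 * y 2 + x 2 * y 1]
  | .A06, x, y => ![x 0 * y 0, x 0 * y 1 + x 1 * y 0, x 0 * y 2 + x 2 * y 0]
  | .A07, x, y => ![x 0 * y 0, x 0 * y 1 + x 1 * y 0, x 0 * y 2 + x 2 * y 0 + x 1 * y 1]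
  | .A08, x, y => ![x 0 * y 0, x 1 * y 1, 0]
  | .A09, x, y => ![x 0 * y 0, x 0 * y 1 + x 1 * y 0, 0]
  | .A10, x, y => ![x 0 * y 0, 0, 0]
  | .A11, x, y => ![x 0 * y 0, 0, x 1 * y 1]
  | .A20, x, y => ![x 1 * y 2 - x 2 * y 1, 0, 0]
  | .A21, x, y => ![x 0 * y 2 - x 2 * y 0, x 1 * y 2 - x 2 * y 1, 0]
  | .A22 α, x, y =>
    ![x 0 * y 2 - x 2 * y 0, x 0 * y 2 - x 2 * y 0 + α * (x 1 * y 2 - x 2 * y 1), 0]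
  | .A23, x, y => ![x 1 * y 2 - x 2 * y 1, x 2 * y 0 - x 0 * y 2, x 0 * y 1 - x 1 * y 0]
  | .A24 α, x, y => ![x 0 * y 2 - x 2 * y 0, α * (x 1 * y 2 - x 2 * y 1),
      x 0 * y 1 - x 1 * y 0 + (x 0 * y 2 - x 2 * y 0)]
  | .A25, x, y => ![x 0 * y 1 - x 1 * y 0, x 1 * y 2 - x 2 * y 1, 0]
  | .A26, x, y => ![x 0 * y 2 - x 2 * y 0, x 1 * y 2 - x 2 * y 1, x 0 * y 1 - x 1 * y 0]
  | .A27, x, y => ![0, x 0 * y 0, x 0 * y 2 - x 2 * y 0]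
  | .A28, x, y => ![0, x 0 * y 0 + (x 0 * y 2 - x 2 * y 0), 0]
  | .A29, x, y => ![x 0 * y 0, x 0 * y 1 + x 1 * y 0,
      x 0 * y 2 + x 2 * y 0 + (x 1 * y 2 - x 2 * y 1)]
  | .A30, x, y => ![x 0 * y 0, 0, x 1 * y 2 - x 2 * y 1]

theorem alg_mul_coord {N : Name} (x y : Alg N) : (x * y).coord = mulVec N x.coord y.coord := by
  funext k
  rw [mul_coord]
  simp only [Fin.sum_univ_three]
  generalize x.coord = x
  generalize y.coord = y
  revert k
  rw [Fin.forall_fin_succ, Fin.forall_fin_two]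
  cases N <;> refine ⟨?_, ?_, ?_⟩ <;> simp [table, mulVec, e₁, e₂, e₃] <;> ring

theorem isKokoris_alg (N : Name) : IsKokoris (Alg N) := by
  constructor
  · intro x y
    refine ext_coord fun k => ?_
    simp only [associator_apply, sub_coord, alg_mul_coord, zero_coord]
    generalize x.coord = x
    generalize y.coord = y
    revert k
    rw [Fin.forall_fin_succ, Fin.forall_fin_two]
    cases N <;> refine ⟨?_, ?_, ?_⟩ <;> simp [mulVec] <;> ring
  · intro x y z
    refine ext_coord fun k => ?_
    have h : ∀ x y : Alg N, (plusMul x y).coord =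
        fun k => 1 / 2 * (mulVec N x.coord y.coord k + mulVec N y.coord x.coord k) := by
      intro x y
      funext k
      simp only [plusMul, smul_coord, add_coord, alg_mul_coord]
    simp only [h]
    generalize x.coord = x
    generalize y.coord = y
    generalize z.coord = z
    revert k
    rw [Fin.forall_fin_succ, Fin.forall_fin_two]
    cases N <;> refine ⟨?_, ?_, ?_⟩ <;> simp [mulVec] <;> ring

end Kokoris

/-! ### Flexible algebras: the commutator is a biderivation of the plus algebra -/

section Flexible

variable {K : Type*} [NonUnitalNonAssocRing K]

/-- Polarization of (x, y, x) = 0 in its outer variable. -/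
theorem flexible_linearized (hf : ∀ x y : K, associator x y x = 0) (x y z : K) :
    x * y * z - x * (y * z) + (z * y * x - z * (y * x)) = 0 := by
  have h := hf (x + z) y
  have h1 := hf x y
  have h2 := hf z y
  simp only [associator_apply] at h h1 h2
  simp only [add_mul, mul_add] at h
  linear_combination (norm := module) h - h1 - h2

/-- The commutator in a flexible algebra satisfies the Leibniz rule over the symmetrized product. -/
theorem commutator_symm_mul (hf : ∀ x y : K, associator x y x = 0) (x y z : K) :
    (x * y + y * x) * z - z * (x * y + y * x) =
      (x * (y * z - z * y) + (y * z - z * y) * x) + (y * (x * z - z * x) + (x * z - z * x) * y) := by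
  -- The linearized identity is symmetric in its outer arguments, so only the choice of the middle
  -- one matters; the middle z enters with the opposite sign.
  have h1 := flexible_linearized hf x y z
  have h2 := flexible_linearized hf z x y
  have h3 := flexible_linearized hf y z x
  simp only [add_mul, mul_add, sub_mul, mul_sub]
  linear_combination (norm := module) h1 + h2 - h3

end Flexible

/-- The vector space `A` with the product `x ∘ y = ½ (x y + y x)`. -/
def Plus (A : Type*) : Type _ := A

namespace Plus

variable {A : Type*} [NonUnitalNonAssocRing A] [Module ℂ A]

instance : AddCommGroup (Plus A) := inferInstanceAs (AddCommGroup A)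

instance : Module ℂ (Plus A) := inferInstanceAs (Module ℂ A)

/-- The identity map from an algebra to its plus algebra. -/
def of (A : Type*) [NonUnitalNonAssocRing A] [Module ℂ A] : A ≃ₗ[ℂ] Plus A :=
  LinearEquiv.refl ℂ A

theorem plusMul_comm (x y : A) : plusMul x y = plusMul y x := by
  rw [plusMul, plusMul, add_comm]

theorem plusMul_add (x y z : A) : plusMul x (y + z) = plusMul x y + plusMul x z := by
  simp only [plusMul, mul_add, add_mul]
  module

theorem add_plusMul (x y z : A) : plusMul (x + y) z = plusMul x z + plusMul y z := by
  simp only [plusMul_comm _ z, plusMul_add]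

theorem plusMul_smul [IsScalarTower ℂ A A] [SMulCommClass ℂ A A] (c : ℂ) (x y : A) : plusMul x (c • y) = c • plusMul x y := by
  simp only [plusMul, mul_smul_comm, smul_mul_assoc]
  module

theorem plusMul_zero (x : A) : plusMul x 0 = 0 := by
  simp [plusMul]

/-- The plus algebra of a Kokoris algebra as a commutative ring. -/
noncomputable abbrev nonUnitalCommRing (h : IsKokoris A) : NonUnitalCommRing (Plus A) :=
  { (inferInstance : AddCommGroup (Plus A)) with
    mul := fun x y => plusMul (A := A) x y
    left_distrib := plusMul_add (A := A)
    right_distrib := add_plusMul (A := A)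
    zero_mul := fun x => (plusMul_comm (A := A) 0 x).trans (plusMul_zero (A := A) x)
    mul_zero := plusMul_zero (A := A)
    mul_assoc := h.plus_assoc
    mul_comm := plusMul_comm (A := A) }

theorem isScalarTower [IsScalarTower ℂ A A] [SMulCommClass ℂ A A] (h : IsKokoris A) :
    letI := nonUnitalCommRing h
    IsScalarTower ℂ (Plus A) (Plus A) := by
  let := nonUnitalCommRing h
  refine ⟨fun c x y => ?_⟩
  rw [smul_eq_mul, smul_eq_mul, mul_comm, mul_comm x]
  exact plusMul_smul (A := A) c y x

theorem smulCommClass [IsScalarTower ℂ A A] [SMulCommClass ℂ A A] (h : IsKokoris A) :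
    letI := nonUnitalCommRing h
    SMulCommClass ℂ (Plus A) (Plus A) := by
  let := nonUnitalCommRing h
  exact ⟨fun c x y => (plusMul_smul (A := A) c x y).symm⟩

end Plus

/-- If the plus algebra has a given table on some basis, the products of basis vectors are
the table entries plus half the commutators. -/
theorem exists_basis_of_plus {K : Type*} [NonUnitalNonAssocRing K] [Module ℂ K]
    (h : IsKokoris K) {t : MulTable}
    (ht : letI := Plus.nonUnitalCommRing h; AlgIso (Plus K) (TableAlgebra t)) :
    ∃ b : Module.Basis (Fin 3) ℂ K, ∀ i j, b i * b j + b j * b i = (2 : ℂ) • ∑ k, t i j k • b k := by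
  let := Plus.nonUnitalCommRing h
  obtain ⟨b, hb⟩ := exists_basis_of_algIso ht
  refine ⟨b.map (Plus.of K).symm, fun i j => ?_⟩
  have h1 : (Plus.of K).symm (b i * b j) = (1 / 2 : ℂ) •
    ((Plus.of K).symm (b i) * (Plus.of K).symm (b j) +
      (Plus.of K).symm (b j) * (Plus.of K).symm (b i)) := rfl
  rw [hb, map_sum] at h1
  simp only [Module.Basis.map_apply]
  simp only [map_smul] at h1
  rw [h1, smul_smul]
  norm_num

/-! ### Commutative associative algebras of small dimension -/

section CommAlgebra

variable {P : Type*} [NonUnitalCommRing P] [Module ℂ P] [IsScalarTower ℂ P P]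
  [SMulCommClass ℂ P P]

omit [IsScalarTower ℂ P P] in
/-- Over a finite-dimensional algebra, an element that is not nilpotent divides a nonzero
idempotent. -/
theorem exists_idempotent_of_not_isNilpotent [FiniteDimensional ℂ P] {x : P}
    (hx : ¬ IsNilpotent (LinearMap.mulLeft ℂ x)) : ∃ w : P, x * w ≠ 0 ∧ x * w * (x * w) = x * w := by
  set L := LinearMap.mulLeft ℂ x with hL
  obtain ⟨n, hn⟩ := IsArtinian.monotone_stabilizes L.iterateRange
  have hn' : ∀ m, n ≤ m → LinearMap.range (L ^ n) = LinearMap.range (L ^ m) := hn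
  have hpow : ∀ m v, (L ^ (m + 1)) v = (L ^ m) x * v := by
    intro m
    induction m with
    | zero => intro v; simp [hL]
    | succ k ih =>
      intro v
      rw [pow_succ', Module.End.mul_apply, ih v, pow_succ' L k, Module.End.mul_apply]
      simp [hL, mul_assoc]
  -- Here y = xⁿ⁺¹ lies in the stable range, hence in the range of multiplication by y². This gives
  -- y = y(yw), so that yw is idempotent.
  have h1 : (L ^ n) x ∈ LinearMap.range (L ^ (n + 1 + (n + 1))) := by
    rw [← hn' _ (by omega)]
    exact ⟨x, rfl⟩
  obtain ⟨w, hw⟩ := h1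
  rw [pow_add, Module.End.mul_apply, hpow, hpow] at hw
  set y := (L ^ n) x with hy
  have hxw : x * (L ^ n) w = y * w := by
    rw [← hpow, pow_succ', Module.End.mul_apply]; rfl
  refine ⟨(L ^ n) w, ?_, ?_⟩
  · rw [hxw]
    intro h0
    refine hx ⟨n + 1, LinearMap.ext fun v => ?_⟩
    rw [hpow, ← hy, ← hw, h0]
    simp
  · rw [hxw]
    calc y * w * (y * w) = y * (y * w) * w := by
          rw [mul_assoc, mul_assoc, mul_comm w]
      _ = y * w := by rw [hw]

omit [SMulCommClass ℂ P P] [IsScalarTower ℂ P P] in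
/-- In a two-dimensional algebra, a linearly independent pair spans. -/
theorem exists_eq_smul_add_smul (hP : Module.finrank ℂ P = 2) {u v : P}
    (h : ∀ a b : ℂ, a • u + b • v = 0 → a = 0 ∧ b = 0) (w : P) :
    ∃ a b : ℂ, w = a • u + b • v := by
  have hl : LinearIndependent ℂ ![u, v] := by
    rw [LinearIndependent.pair_iff]; exact h
  let b := basisOfLinearIndependentOfCardEqFinrank hl (by simp [hP])
  have hb : ⇑b = ![u, v] := coe_basisOfLinearIndependentOfCardEqFinrank _ _
  refine ⟨b.repr w 0, b.repr w 1, ?_⟩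
  conv_lhs => rw [← b.sum_repr w]
  simp [hb]

omit [IsScalarTower ℂ P P] in
-- Cayley–Hamilton: the characteristic polynomial of a nilpotent operator is a power of X. This
-- bounds the nilpotency index by the dimension.
theorem mulLeft_pow_finrank_eq_zero [FiniteDimensional ℂ P] {x : P}
    (hx : IsNilpotent (LinearMap.mulLeft ℂ x)) :
    LinearMap.mulLeft ℂ x ^ Module.finrank ℂ P = 0 := by
  have h := LinearMap.aeval_self_charpoly (LinearMap.mulLeft ℂ x)
  rw [hx.charpoly_eq_X_pow_finrank] at h
  simpa using h

/-- Classification of commutative associative algebras of dimension two. -/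
theorem exists_pair_of_finrank_eq_two (hP : Module.finrank ℂ P = 2) :
    ∃ u v : P, (∀ a b : ℂ, a • u + b • v = 0 → a = 0 ∧ b = 0) ∧
      ((u * u = 0 ∧ u * v = 0 ∧ v * v = 0) ∨ (u * u = v ∧ u * v = 0 ∧ v * v = 0) ∨
        (u * u = u ∧ u * v = 0 ∧ v * v = 0) ∨ (u * u = u ∧ u * v = v ∧ v * v = 0) ∨
        (u * u = u ∧ u * v = 0 ∧ v * v = v)) := by
  have : FiniteDimensional ℂ P := Module.finite_of_finrank_eq_succ hP
  have hext : ∀ u : P, u ≠ 0 → ∃ v, ∀ a b : ℂ, a • u + b • v = 0 → a = 0 ∧ b = 0 := by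
    intro u hu
    obtain ⟨v, hv⟩ := exists_linearIndependent_pair_of_one_lt_finrank
      (show 1 < Module.finrank ℂ P by omega) hu
    exact ⟨v, LinearIndependent.pair_iff.1 hv⟩
  by_cases hnil : ∀ x : P, IsNilpotent (LinearMap.mulLeft ℂ x)
  · have hx3 : ∀ x y : P, x * (x * y) = 0 := fun x y => by
      have := mulLeft_pow_finrank_eq_zero (hnil x)
      rw [hP] at this
      simpa [pow_two] using LinearMap.congr_fun this y
    by_cases hsq : ∀ u : P, u * u = 0
    · obtain ⟨u, hu⟩ : ∃ u : P, u ≠ 0 := by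
        have := Module.nontrivial_of_finrank_pos (R := ℂ) (M := P) (by omega)
        exact exists_ne 0
      obtain ⟨v, hv⟩ := hext u hu
      refine ⟨u, v, hv, Or.inl ⟨hsq u, ?_, hsq v⟩⟩
      have := hsq (u + v)
      rw [add_mul, mul_add, mul_add, hsq, hsq, mul_comm v u] at this
      have h2 : (2 : ℂ) • (u * v) = 0 := by rw [← this]; module
      simpa using h2
    · push Not at hsq
      obtain ⟨u, hu⟩ := hsq
      refine ⟨u, u * u, fun a b hab => ?_, Or.inr (Or.inl ⟨rfl, hx3 u u, ?_⟩)⟩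
      · have h1 : a • (u * u) = 0 := by
          have := congrArg (u * ·) hab
          simpa [mul_add, mul_smul_comm, hx3] using this
        have ha : a = 0 := by simpa [hu] using h1
        subst ha
        have : b = 0 := by simpa [hu] using hab
        exact ⟨rfl, this⟩
      · rw [mul_assoc, hx3]
  · push Not at hnil
    obtain ⟨x, hx⟩ := hnil
    obtain ⟨w, he0, hee⟩ := exists_idempotent_of_not_isNilpotent hx
    set e := x * w
    obtain ⟨v, hv⟩ := hext e he0
    -- Modulo e, multiplication by e is the scalar b, and idempotency forces b to be 0 or 1. In the
    -- first case v − ae is annihilated by e; in the second a = 0 and e is the unit.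
    obtain ⟨a, b, hab⟩ := exists_eq_smul_add_smul hP hv (e * v)
    have h1 : e * (e * v) = e * v := by rw [← mul_assoc, hee]
    rw [hab, mul_add, mul_smul_comm, mul_smul_comm, hee, hab] at h1
    have h2 := hv (a * b) (b * b - b) (by linear_combination (norm := module) h1)
    have hb : b = 0 ∨ b = 1 := by
      have : b * (b - 1) = 0 := by linear_combination h2.2
      rcases mul_eq_zero.1 this with h | h
      · exact Or.inl h
      · exact Or.inr (by linear_combination h)
    rcases hb with rfl | rfl
    · set v' := v - a • e with hv'
      have hev : e * v' = 0 := by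
        rw [hv', mul_sub, mul_smul_comm, hee, hab]; module
      have hli : ∀ c d : ℂ, c • e + d • v' = 0 → c = 0 ∧ d = 0 := by
        intro c d h
        have := hv (c - d * a) d (by rw [← h, hv']; module)
        obtain ⟨h1, h2⟩ := this
        subst h2
        exact ⟨by linear_combination h1, rfl⟩
      obtain ⟨c, d, hcd⟩ := exists_eq_smul_add_smul hP hli (v' * v')
      have hc : c = 0 := by
        have h3 : e * (v' * v') = 0 := by rw [← mul_assoc, hev, zero_mul]
        rw [hcd, mul_add, mul_smul_comm, mul_smul_comm, hee, hev] at h3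
        simpa [he0] using h3
      subst hc
      rw [zero_smul, zero_add] at hcd
      by_cases hd : d = 0
      · subst hd
        exact ⟨e, v', hli, Or.inr (Or.inr (Or.inl ⟨hee, hev, by rw [hcd, zero_smul]⟩))⟩
      · refine ⟨e, d⁻¹ • v', fun p q h => ?_,
          Or.inr (Or.inr (Or.inr (Or.inr ⟨hee, by rw [mul_smul_comm, hev, smul_zero], ?_⟩)))⟩
        · have := hli p (q * d⁻¹) (by rw [← h]; module)
          simpa [hd] using this
        · rw [smul_mul_smul_comm, hcd, smul_smul]
          congr 1; field_simp
    · have ha : a = 0 := by simpa using h2.1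
      subst ha
      have hev : e * v = v := by rw [hab]; module
      have hve : v * e = v := by rw [mul_comm, hev]
      obtain ⟨c, d, hcd⟩ := exists_eq_smul_add_smul hP hv (v * v)
      -- Completing the square in v² = ce + dv, so that the shifted v' satisfies v'² = r²e.
      obtain ⟨r, hr⟩ := IsAlgClosed.exists_eq_mul_self (c + d ^ 2 / 4)
      set v' := v - (d / 2) • e with hv'
      have hev' : e * v' = v' := by
        rw [hv', mul_sub, mul_smul_comm, hee, hev]
      have hve' : v' * e = v' := by rw [mul_comm, hev']
      have hvv' : v' * v' = (r * r) • e := by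
        rw [← hr, hv']
        simp only [sub_mul, mul_sub, smul_mul_assoc, mul_smul_comm, hee, hev, hve, hcd]
        module
      have hli : ∀ c d : ℂ, c • e + d • v' = 0 → c = 0 ∧ d = 0 := by
        intro p q h
        have := hv (p - q * (d / 2)) q (by rw [← h, hv']; module)
        obtain ⟨h1, h2⟩ := this
        subst h2
        exact ⟨by linear_combination h1, rfl⟩
      by_cases hr0 : r = 0
      · subst hr0
        exact ⟨e, v', hli, Or.inr (Or.inr (Or.inr (Or.inl ⟨hee, hev', by simp [hvv']⟩)))⟩
      -- Since (v'/r)² = e, these are the two orthogonal idempotents of ℂ × ℂ.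
      · refine ⟨(1 / 2 : ℂ) • (e + r⁻¹ • v'), (1 / 2 : ℂ) • (e - r⁻¹ • v'), fun p q h => ?_,
          Or.inr (Or.inr (Or.inr (Or.inr ⟨?_, ?_, ?_⟩)))⟩
        · have := hli ((p + q) / 2) ((p - q) / 2 * r⁻¹) (by rw [← h]; module)
          simp only [mul_eq_zero, inv_eq_zero, hr0, or_false, div_eq_zero_iff, OfNat.ofNat_ne_zero]
            at this
          exact ⟨by linear_combination (this.1 + this.2) / 2,
            by linear_combination (this.1 - this.2) / 2⟩
        all_goals
          simp only [sub_mul, mul_sub, add_mul, mul_add, smul_mul_assoc, mul_smul_comm, hee, hev',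
            hve', hvv', smul_add, smul_sub, smul_smul]
          match_scalars <;> field_simp <;> ring

end CommAlgebra

/-! ### Commutative associative algebras of dimension three -/

section CommAlgebraThree

set_option linter.unusedSimpArgs false

variable {P : Type*} [NonUnitalCommRing P] [Module ℂ P] [IsScalarTower ℂ P P]
  [SMulCommClass ℂ P P]

open Kokoris

/-- A two-dimensional subalgebra has a basis with one of the standard tables. -/
theorem exists_pair_of_subalgebra (S : NonUnitalSubalgebra ℂ P) (hS : Module.finrank ℂ S = 2) :
    ∃ u ∈ S, ∃ v ∈ S, (∀ a b : ℂ, a • u + b • v = 0 → a = 0 ∧ b = 0) ∧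
      (∀ w ∈ S, ∃ a b : ℂ, w = a • u + b • v) ∧
      ((u * u = 0 ∧ u * v = 0 ∧ v * v = 0) ∨ (u * u = v ∧ u * v = 0 ∧ v * v = 0) ∨
        (u * u = u ∧ u * v = 0 ∧ v * v = 0) ∨ (u * u = u ∧ u * v = v ∧ v * v = 0) ∨
        (u * u = u ∧ u * v = 0 ∧ v * v = v)) := by
  obtain ⟨⟨u, hu⟩, ⟨v, hv⟩, hli, h⟩ := exists_pair_of_finrank_eq_two hS
  refine ⟨u, hu, v, hv, fun a b hab => hli a b (Subtype.ext hab), fun w hw => ?_, ?_⟩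
  · obtain ⟨a, b, hab⟩ := exists_eq_smul_add_smul hS hli ⟨w, hw⟩
    exact ⟨a, b, congrArg Subtype.val hab⟩
  · simpa [Subtype.ext_iff] using h

/-- The subalgebra of elements annihilated by `e`. -/
def annihilatorSubalgebra (e : P) : NonUnitalSubalgebra ℂ P :=
  { LinearMap.ker (LinearMap.mulLeft ℂ e) with
    mul_mem' := fun {x y} hx _ => by
      change e * x = 0 at hx
      change e * (x * y) = 0
      rw [← mul_assoc, hx, zero_mul] }

/-- The subalgebra of multiples of `e`. -/
def multiplesSubalgebra (e : P) : NonUnitalSubalgebra ℂ P :=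
  { LinearMap.range (LinearMap.mulLeft ℂ e) with
    mul_mem' := fun {x y} hx _ => by
      obtain ⟨z, rfl⟩ := hx
      exact ⟨z * y, (mul_assoc e z y).symm⟩ }

omit [IsScalarTower ℂ P P] in
theorem mem_multiplesSubalgebra {e x : P} (he : e * e = e) (hx : x ∈ multiplesSubalgebra e) :
    e * x = x := by
  obtain ⟨z, rfl⟩ := hx
  change e * (e * z) = e * z
  rw [← mul_assoc, he]

set_option maxHeartbeats 400000 in
-- The Peirce decomposition is ℂe plus the annihilator of e, so the algebra is a direct sum of ℂ and
-- one of the five two-dimensional algebras.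
theorem exists_commutativeList_of_finrank_ker_eq_two (hP : Module.finrank ℂ P = 3) {e : P}
    (he : e * e = e) (he0 : e ≠ 0)
    (hk : Module.finrank ℂ (LinearMap.ker (LinearMap.mulLeft ℂ e)) = 2) :
    ∃ N ∈ commutativeList, AlgIso P (Alg N) := by
  obtain ⟨u, hu, v, hv, hli, -, h⟩ := exists_pair_of_subalgebra (annihilatorSubalgebra e) hk
  replace hu : e * u = 0 := hu
  replace hv : e * v = 0 := hv
  have hue : u * e = 0 := by rw [mul_comm, hu]
  have hve : v * e = 0 := by rw [mul_comm, hv]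
  have hli3 : ∀ a b c : ℂ, a • e + b • u + c • v = 0 → a = 0 ∧ b = 0 ∧ c = 0 := by
    intro a b c habc
    have h1 := congrArg (e * ·) habc
    simp only [mul_add, mul_smul_comm, he, hu, hv, smul_zero, add_zero, mul_zero] at h1
    have ha : a = 0 := by simpa [he0] using h1
    subst ha
    exact ⟨rfl, hli b c (by simpa using habc)⟩
  rcases h with ⟨h1, h2, h3⟩ | ⟨h1, h2, h3⟩ | ⟨h1, h2, h3⟩ | ⟨h1, h2, h3⟩ | ⟨h1, h2, h3⟩
  · refine ⟨.A10, by simp [commutativeList], algIso_of_triple hP _ hli3 ?_ ?_ ?_ ?_ ?_ ?_ ?_ ?_ ?_⟩ <;>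
      simp [table, e₁, e₂, e₃, mul_comm v u, he, hu, hv, hue, hve, h1, h2, h3]
  · refine ⟨.A11, by simp [commutativeList], algIso_of_triple hP _ hli3 ?_ ?_ ?_ ?_ ?_ ?_ ?_ ?_ ?_⟩ <;>
      simp [table, e₁, e₂, e₃, mul_comm v u, he, hu, hv, hue, hve, h1, h2, h3]
  · refine ⟨.A08, by simp [commutativeList], algIso_of_triple hP _ hli3 ?_ ?_ ?_ ?_ ?_ ?_ ?_ ?_ ?_⟩ <;>
      simp [table, e₁, e₂, e₃, mul_comm v u, he, hu, hv, hue, hve, h1, h2, h3]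
  · refine ⟨.A05, by simp [commutativeList], algIso_of_triple hP _ hli3 ?_ ?_ ?_ ?_ ?_ ?_ ?_ ?_ ?_⟩ <;>
      simp [table, e₁, e₂, e₃, mul_comm v u, he, hu, hv, hue, hve, h1, h2, h3]
  · refine ⟨.A04, by simp [commutativeList], algIso_of_triple hP _ hli3 ?_ ?_ ?_ ?_ ?_ ?_ ?_ ?_ ?_⟩ <;>
      simp [table, e₁, e₂, e₃, mul_comm v u, he, hu, hv, hue, hve, h1, h2, h3]

/-- Here eP is a two-dimensional algebra with unit e, and the annihilator is a line ℂw with w² = cw.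
Only two of the five two-dimensional tables are unital, and c is 0 or can be scaled to 1. -/
theorem exists_commutativeList_of_finrank_ker_eq_one (hP : Module.finrank ℂ P = 3) {e : P}
    (he : e * e = e) (hk : Module.finrank ℂ (LinearMap.ker (LinearMap.mulLeft ℂ e)) = 1) :
    ∃ N ∈ commutativeList, AlgIso P (Alg N) := by
  have : FiniteDimensional ℂ P := Module.finite_of_finrank_eq_succ hP
  have hr : Module.finrank ℂ (multiplesSubalgebra e) = 2 := by
    have h1 := LinearMap.finrank_range_add_finrank_ker (LinearMap.mulLeft ℂ e)
    have h2 : Module.finrank ℂ (multiplesSubalgebra e) =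
      Module.finrank ℂ (LinearMap.range (LinearMap.mulLeft ℂ e)) := rfl
    omega
  obtain ⟨u, hu, v, hv, hli, hspan, h⟩ := exists_pair_of_subalgebra (multiplesSubalgebra e) hr
  replace hu := mem_multiplesSubalgebra he hu
  replace hv := mem_multiplesSubalgebra he hv
  obtain ⟨⟨w, hw⟩, hw0, hwspan⟩ := finrank_eq_one_iff'.1 hk
  replace hw : e * w = 0 := hw
  replace hw0 : w ≠ 0 := fun h => hw0 (Subtype.ext h)
  have hew : ∀ x, e * x = x → x * w = 0 := fun x hx => by
    rw [← hx, mul_comm e x, mul_assoc, hw, mul_zero]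
  have huw := hew u hu
  have hvw := hew v hv
  have hwu : w * u = 0 := by rw [mul_comm, huw]
  have hwv : w * v = 0 := by rw [mul_comm, hvw]
  obtain ⟨c, hc⟩ : ∃ c : ℂ, w * w = c • w := by
    obtain ⟨c, hc⟩ := hwspan ⟨w * w, show e * (w * w) = 0 by rw [← mul_assoc, hw, zero_mul]⟩
    exact ⟨c, (congrArg Subtype.val hc).symm⟩
  have hli3 : ∀ a b c : ℂ, a • u + b • v + c • w = 0 → a = 0 ∧ b = 0 ∧ c = 0 := by
    intro a b c habc
    have h1 := congrArg (e * ·) habc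
    simp only [mul_add, mul_smul_comm, hu, hv, hw, smul_zero, add_zero, mul_zero] at h1
    obtain ⟨rfl, rfl⟩ := hli a b h1
    exact ⟨rfl, rfl, by simpa [hw0] using habc⟩
  -- The unit e of eP written in the basis u, v; in the three non-unital tables e would annihilate u
  -- or v, or send v to 0.
  obtain ⟨p, q, hpq⟩ := hspan e ⟨e, he⟩
  have hu0 : u ≠ 0 := fun h0 => by simpa using (hli 1 0 (by simp [h0])).1
  have hv0 : v ≠ 0 := fun h0 => by simpa using (hli 0 1 (by simp [h0])).2
  rcases h with ⟨h1, h2, h3⟩ | ⟨h1, h2, h3⟩ | ⟨h1, h2, h3⟩ | ⟨h1, h2, h3⟩ | ⟨h1, h2, h3⟩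
  · rw [hpq, add_mul, smul_mul_assoc, smul_mul_assoc, mul_comm v u, h1, h2] at hu
    simp at hu
    exact absurd hu.symm hu0
  · rw [hpq, add_mul, smul_mul_assoc, smul_mul_assoc, h3, h2] at hv
    simp at hv
    exact absurd hv.symm hv0
  · rw [hpq, add_mul, smul_mul_assoc, smul_mul_assoc, h3, h2] at hv
    simp at hv
    exact absurd hv.symm hv0
  · by_cases hc0 : c = 0
    · subst hc0
      refine ⟨.A09, by simp [commutativeList],
        algIso_of_triple hP _ hli3 ?_ ?_ ?_ ?_ ?_ ?_ ?_ ?_ ?_⟩ <;>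
        simp [table, e₁, e₂, e₃, mul_comm v u, h1, h2, h3, huw, hvw, hwu, hwv, hc]
    · refine ⟨.A05, by simp [commutativeList], algIso_of_triple hP _ (x := c⁻¹ • w) (y := u) (z := v)
        (fun p q r h => ?_) ?_ ?_ ?_ ?_ ?_ ?_ ?_ ?_ ?_⟩
      · have := hli3 q r (p * c⁻¹) (by rw [← h]; module)
        simp only [mul_eq_zero, inv_eq_zero, hc0, or_false] at this
        tauto
      all_goals
        simp [table, e₁, e₂, e₃, mul_comm v u, h1, h2, h3, huw, hvw, hwu, hwv, hc, smul_mul_assoc,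
          mul_smul_comm, smul_smul, hc0]
  · by_cases hc0 : c = 0
    · subst hc0
      refine ⟨.A08, by simp [commutativeList],
        algIso_of_triple hP _ hli3 ?_ ?_ ?_ ?_ ?_ ?_ ?_ ?_ ?_⟩ <;>
        simp [table, e₁, e₂, e₃, mul_comm v u, h1, h2, h3, huw, hvw, hwu, hwv, hc]
    · refine ⟨.A04, by simp [commutativeList], algIso_of_triple hP _ (x := c⁻¹ • w) (y := u) (z := v)
        (fun p q r h => ?_) ?_ ?_ ?_ ?_ ?_ ?_ ?_ ?_ ?_⟩
      · have := hli3 q r (p * c⁻¹) (by rw [← h]; module)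
        simp only [mul_eq_zero, inv_eq_zero, hc0, or_false] at this
        tauto
      all_goals
        simp [table, e₁, e₂, e₃, mul_comm v u, h1, h2, h3, huw, hvw, hwu, hwv, hc, smul_mul_assoc,
          mul_smul_comm, smul_smul, hc0]

/-- The elements of trace zero form a subalgebra if they are all nilpotent. -/
noncomputable def traceZeroSubalgebra (h : ∀ x : P, LinearMap.trace ℂ P (LinearMap.mulLeft ℂ x) = 0 →
    IsNilpotent (LinearMap.mulLeft ℂ x)) [FiniteDimensional ℂ P] : NonUnitalSubalgebra ℂ P :=
  { LinearMap.ker (LinearMap.trace ℂ P ∘ₗ LinearMap.mul ℂ P) with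
    mul_mem' := fun {x y} hx _ => by
      change LinearMap.trace ℂ P (LinearMap.mulLeft ℂ (x * y)) = 0
      have hc : Commute (LinearMap.mulLeft ℂ x) (LinearMap.mulLeft ℂ y) :=
        LinearMap.ext fun z => mul_left_comm x y z
      have : LinearMap.mulLeft ℂ (x * y) = LinearMap.mulLeft ℂ x * LinearMap.mulLeft ℂ y :=
        LinearMap.ext fun z => mul_assoc x y z
      rw [this]
      -- A product of commuting operators is nilpotent as soon as one factor is, and a nilpotent
      -- operator has trace zero.
      exact (LinearMap.isNilpotent_trace_of_isNilpotent (hc.isNilpotent_mul_right (h x hx))).eq_zero }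

/-- A unital algebra in which every nonzero idempotent is injective is local. -/
theorem exists_commutativeList_of_local (hP : Module.finrank ℂ P = 3) {e : P} (he0 : e ≠ 0)
    (hu : ∀ x, e * x = x)
    (hid : ∀ f : P, f * f = f → f ≠ 0 → ∀ x, f * x = 0 → x = 0) :
    ∃ N ∈ commutativeList, AlgIso P (Alg N) := by
  have : FiniteDimensional ℂ P := Module.finite_of_finrank_eq_succ hP
  have hue : ∀ x, x * e = x := fun x => by rw [mul_comm, hu]
  have hone : LinearMap.mulLeft ℂ e = 1 := LinearMap.ext fun x => hu x
  have hnil : ∀ x y : P, y ≠ 0 → x * y = 0 → IsNilpotent (LinearMap.mulLeft ℂ x) := by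
    intro x y hy hxy
    -- A non-nilpotent x divides a nonzero idempotent, which acts injectively by hypothesis, so x
    -- could not kill y.
    by_contra hx
    obtain ⟨w, hw0, hw⟩ := exists_idempotent_of_not_isNilpotent hx
    exact hy (hid _ hw hw0 y (by rw [mul_assoc, mul_comm w, ← mul_assoc, hxy, zero_mul]))
  have htr : ∀ x : P, LinearMap.trace ℂ P (LinearMap.mulLeft ℂ x) = 0 →
      IsNilpotent (LinearMap.mulLeft ℂ x) := by
    intro x hx
    have : Nontrivial P := ⟨e, 0, he0⟩
    -- For an eigenvalue c the element x − ce is a zero divisor, hence nilpotent. Comparing traces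
    -- gives 3c = 0, so x itself is nilpotent.
    obtain ⟨c, hc⟩ := Module.End.exists_eigenvalue (LinearMap.mulLeft ℂ x)
    obtain ⟨y, hy⟩ := hc.exists_hasEigenvector
    have hxy : x * y = c • y := hy.apply_eq_smul
    have h1 : IsNilpotent (LinearMap.mulLeft ℂ (x - c • e)) := hnil _ y hy.2 (by
      rw [sub_mul, hxy, smul_mul_assoc, hu, sub_self])
    have h2 := (LinearMap.isNilpotent_trace_of_isNilpotent h1).eq_zero
    have h3 : LinearMap.mulLeft ℂ (x - c • e) = LinearMap.mulLeft ℂ x - c • 1 := by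
      rw [← hone]
      exact map_sub (LinearMap.mul ℂ P) x (c • e) |>.trans (by rw [map_smul]; rfl)
    rw [h3, map_sub, hx, map_smul, LinearMap.trace_one, hP] at h2
    have hc0 : c = 0 := by simpa using h2
    simpa [hc0] using h1
  have hr : Module.finrank ℂ (traceZeroSubalgebra htr) = 2 := by
    have h1 := LinearMap.finrank_range_add_finrank_ker (LinearMap.trace ℂ P ∘ₗ LinearMap.mul ℂ P)
    have h2 : Module.finrank ℂ (traceZeroSubalgebra htr) =
      Module.finrank ℂ (LinearMap.ker (LinearMap.trace ℂ P ∘ₗ LinearMap.mul ℂ P)) := rfl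
    have h3 : LinearMap.range (LinearMap.trace ℂ P ∘ₗ LinearMap.mul ℂ P) = ⊤ := by
      rw [LinearMap.range_eq_top]
      refine LinearMap.surjective fun h0 => ?_
      -- The unit has trace 3, so the trace functional is nonzero and its kernel is a plane.
      have h4 : LinearMap.trace ℂ P (LinearMap.mulLeft ℂ e) = 0 := LinearMap.congr_fun h0 e
      rw [hone, LinearMap.trace_one, hP] at h4
      norm_num at h4
    rw [h3, finrank_top, Module.finrank_self] at h1
    omega
  obtain ⟨u, hus, v, hvs, hli, hspan, h⟩ := exists_pair_of_subalgebra _ hr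
  replace hus : LinearMap.trace ℂ P (LinearMap.mulLeft ℂ u) = 0 := hus
  replace hvs : LinearMap.trace ℂ P (LinearMap.mulLeft ℂ v) = 0 := hvs
  have hli3 : ∀ a b c : ℂ, a • e + b • u + c • v = 0 → a = 0 ∧ b = 0 ∧ c = 0 := by
    intro a b c habc
    have h1 := congrArg (LinearMap.trace ℂ P ∘ₗ LinearMap.mul ℂ P) habc
    have h2 : LinearMap.trace ℂ P (LinearMap.mul ℂ P u) = 0 := hus
    have h3 : LinearMap.trace ℂ P (LinearMap.mul ℂ P v) = 0 := hvs
    have h4 : LinearMap.mul ℂ P e = 1 := hone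
    simp only [map_add, map_smul, LinearMap.comp_apply, h2, h3, h4, LinearMap.trace_one, hP,
      map_zero] at h1
    have ha : a = 0 := by simpa using h1
    subst ha
    exact ⟨rfl, hli b c (by simpa using habc)⟩
  have hu0 : u ≠ 0 := fun h0 => by simpa using (hli 1 0 (by simp [h0])).1
  have huu : u * u ≠ u := by
    intro huu
    have h1 := mulLeft_pow_finrank_eq_zero (htr u hus)
    have h2 := LinearMap.congr_fun h1 u
    rw [hP] at h2
    simp [pow_succ, huu] at h2
    exact hu0 h2
  rcases h with ⟨h1, h2, h3⟩ | ⟨h1, h2, h3⟩ | ⟨h1, h2, h3⟩ | ⟨h1, h2, h3⟩ | ⟨h1, h2, h3⟩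
  · refine ⟨.A06, by simp [commutativeList],
      algIso_of_triple hP _ hli3 ?_ ?_ ?_ ?_ ?_ ?_ ?_ ?_ ?_⟩ <;>
      simp [table, e₁, e₂, e₃, mul_comm v u, h1, h2, h3, hu, hue]
  · refine ⟨.A07, by simp [commutativeList],
      algIso_of_triple hP _ hli3 ?_ ?_ ?_ ?_ ?_ ?_ ?_ ?_ ?_⟩ <;>
      simp [table, e₁, e₂, e₃, mul_comm v u, h1, h2, h3, hu, hue]
  all_goals exact absurd h1 huu

end CommAlgebraThree

/-! ### Nilpotent commutative algebras, and the full commutative classification. -/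

section CommAlgebraClassification

set_option linter.unusedSimpArgs false

variable {P : Type*} [NonUnitalCommRing P] [Module ℂ P] [IsScalarTower ℂ P P]
  [SMulCommClass ℂ P P]

open Kokoris

omit [IsScalarTower ℂ P P] [SMulCommClass ℂ P P] in
/-- In a three-dimensional space a linearly independent pair extends to a triple. -/
theorem exists_linearIndependent_triple (hP : Module.finrank ℂ P = 3) {x y : P}
    (h : ∀ a b : ℂ, a • x + b • y = 0 → a = 0 ∧ b = 0) :
    ∃ z : P, ∀ a b c : ℂ, a • x + b • y + c • z = 0 → a = 0 ∧ b = 0 ∧ c = 0 := by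
  have : FiniteDimensional ℂ P := Module.finite_of_finrank_eq_succ hP
  obtain ⟨z, hz⟩ : ∃ z, z ∉ Submodule.span ℂ {x, y} := by
    by_contra! hall
    have htop : Submodule.span ℂ ({x, y} : Set P) = ⊤ := Submodule.eq_top_iff'.2 hall
    classical
    have h2 := finrank_span_finset_le_card (R := ℂ) ({x, y} : Finset P)
    rw [Finset.coe_pair, Set.finrank, htop, finrank_top, hP] at h2
    have := Finset.card_le_two (a := x) (b := y)
    omega
  refine ⟨z, fun a b c habc => ?_⟩
  have hc : c = 0 := by
    by_contra hc
    refine hz (Submodule.mem_span_pair.2 ⟨-(c⁻¹ * a), -(c⁻¹ * b), ?_⟩)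
    have h1 : c • z = -(a • x + b • y) := by rw [eq_neg_iff_add_eq_zero, ← habc]; abel
    have h2 : z = c⁻¹ • (c • z) := by rw [smul_smul, inv_mul_cancel₀ hc, one_smul]
    rw [h2, h1]; module
  subst hc
  obtain ⟨ha, hb⟩ := h a b (by simpa using habc)
  exact ⟨ha, hb, rfl⟩

/-- If x³ ≠ 0, the powers of x form a basis. Otherwise polarizing x³ = 0 twice makes all triple
products vanish, and when all products are multiples of one square the multiplication is a symmetric
bilinear form, classified by its rank. -/
theorem exists_commutativeList_of_nil (hP : Module.finrank ℂ P = 3)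
    (hnil : ∀ x : P, IsNilpotent (LinearMap.mulLeft ℂ x)) :
    ∃ N ∈ commutativeList, AlgIso P (Alg N) := by
  have : FiniteDimensional ℂ P := Module.finite_of_finrank_eq_succ hP
  have h4 : ∀ x y : P, x * (x * (x * y)) = 0 := fun x y => by
    have := mulLeft_pow_finrank_eq_zero (hnil x)
    rw [hP] at this
    simpa [pow_succ] using LinearMap.congr_fun this y
  by_cases h3 : ∃ x : P, x * (x * x) ≠ 0
  · obtain ⟨x, hx⟩ := h3
    have h22 : x * x * (x * x) = 0 := by rw [mul_assoc, h4]
    have h23 : x * x * (x * (x * x)) = 0 := by rw [mul_assoc, h4]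
    have h33 : x * (x * x) * (x * (x * x)) = 0 := by rw [mul_assoc, mul_assoc, h4]
    have h21 : x * x * x = x * (x * x) := mul_assoc _ _ _
    have h31 : x * (x * x) * x = 0 := by rw [mul_comm, h4]
    have h32 : x * (x * x) * (x * x) = 0 := by rw [mul_comm, h23]
    refine ⟨.A03, by simp [commutativeList], algIso_of_triple hP _ (x := x) (y := x * x)
      (z := x * (x * x)) (fun a b c h => ?_) ?_ ?_ ?_ ?_ ?_ ?_ ?_ ?_ ?_⟩
    · have h1 := congrArg (fun y => x * (x * y)) h
      simp only [mul_add, mul_smul_comm, h4, smul_zero, add_zero, mul_zero] at h1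
      have ha : a = 0 := by simpa [hx] using h1
      subst ha
      have h2 := congrArg (fun y => x * y) h
      simp only [mul_add, mul_smul_comm, h4, smul_zero, add_zero, mul_zero, zero_smul, zero_add]
        at h2
      have hb : b = 0 := by simpa [hx] using h2
      subst hb
      simpa [hx] using h
    all_goals simp [table, e₁, e₂, e₃, h22, h23, h33, h21, h31, h32, h4]
  push Not at h3
  have hxxy : ∀ x y : P, x * x * y = 0 := by
    intro x y
    have h1 := h3 (x + y)
    have h2 := h3 (x - y)
    simp only [mul_add, add_mul, mul_sub, sub_mul, h3, mul_comm y x, mul_left_comm y x] at h1 h2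
    -- (x + y)³ − (x − y)³ = 6x²y + 2y³.
    have : (6 : ℂ) • (x * (x * y)) = 0 := by
      linear_combination (norm := module) h1 - h2
    rw [mul_assoc]
    simpa using this
  have hxyz : ∀ x y z : P, x * y * z = 0 := by
    intro x y z
    have h1 := hxxy (x + y) z
    rw [add_mul, mul_add, mul_add, add_mul, add_mul, add_mul, hxxy, hxxy, mul_comm y x] at h1
    have : (2 : ℂ) • (x * y * z) = 0 := by
      linear_combination (norm := module) h1
    simpa using this
  by_cases hsq : ∀ x : P, x * x = 0
  · have hmul : ∀ x y : P, x * y = 0 := by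
      intro x y
      have h1 := hsq (x + y)
      rw [add_mul, mul_add, mul_add, hsq, hsq, mul_comm y x] at h1
      have : (2 : ℂ) • (x * y) = 0 := by
        linear_combination (norm := module) h1
      simpa using this
    refine ⟨.A00, by simp [commutativeList], algIso_of_basis _ (Module.finBasisOfFinrankEq ℂ P hP)
      fun i j => ?_⟩
    rw [hmul]
    fin_cases i <;> fin_cases j <;> simp [table]
  push Not at hsq
  obtain ⟨x, hx⟩ := hsq
  have hx2 : ∀ a b : ℂ, a • x + b • (x * x) = 0 → a = 0 ∧ b = 0 := by
    intro a b hab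
    have h1 := congrArg (x * ·) hab
    simp only [mul_add, mul_smul_comm, h3, smul_zero, add_zero, mul_zero] at h1
    have ha : a = 0 := by simpa [hx] using h1
    subst ha
    exact ⟨rfl, by simpa [hx] using hab⟩
  have hann : ∀ y z w : P, w * (y * z) = 0 := fun y z w => by rw [mul_comm, hxyz]
  by_cases hw : ∃ p q : P, ∀ c : ℂ, p * q ≠ c • (x * x)
  · obtain ⟨p, q, hpq⟩ := hw
    refine ⟨.A01, by simp [commutativeList], algIso_of_triple hP _ (x := x) (y := x * x)
      (z := p * q) (fun a b c h => ?_) ?_ ?_ ?_ ?_ ?_ ?_ ?_ ?_ ?_⟩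
    · have hc : c = 0 := by
        by_contra hc
        have h1 := congrArg (x * ·) h
        simp only [mul_add, mul_smul_comm, hann, smul_zero, add_zero, mul_zero] at h1
        have ha : a = 0 := by simpa [hx] using h1
        subst ha
        refine hpq (-(c⁻¹ * b)) ?_
        have h2 : c • (p * q) = -(b • (x * x)) := by
          rw [eq_neg_iff_add_eq_zero, ← h]; module
        have h3 : p * q = c⁻¹ • (c • (p * q)) := by rw [smul_smul, inv_mul_cancel₀ hc, one_smul]
        rw [h3, h2]; module
      subst hc
      have := hx2 a b (by simpa using h)
      exact ⟨this.1, this.2, rfl⟩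
    all_goals simp [table, e₁, e₂, e₃, hann, hxyz]
  push Not at hw
  obtain ⟨z, hz⟩ := exists_linearIndependent_triple hP hx2
  obtain ⟨b, hb⟩ := hw x z
  set y := z - b • x with hy
  have hxy : x * y = 0 := by rw [hy, mul_sub, mul_smul_comm, hb, sub_self]
  have hyx : y * x = 0 := by rw [mul_comm, hxy]
  have hli : ∀ a b c : ℂ, a • x + b • (x * x) + c • y = 0 → a = 0 ∧ b = 0 ∧ c = 0 := by
    intro p q r h
    obtain ⟨h1, h2, rfl⟩ := hz (p - r * b) q r (by rw [← h, hy]; module)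
    exact ⟨by linear_combination h1, h2, rfl⟩
  obtain ⟨c, hc⟩ := hw y y
  obtain ⟨r, rfl⟩ := IsAlgClosed.exists_eq_mul_self c
  by_cases hr : r = 0
  · subst hr
    refine ⟨.A01, by simp [commutativeList], algIso_of_triple hP _ hli
      ?_ ?_ ?_ ?_ ?_ ?_ ?_ ?_ ?_⟩ <;> simp [table, e₁, e₂, e₃, hann, hxyz, hxy, hyx, hc]
  · have hI := Complex.I_mul_I
    -- As y² = r²x² and xy = 0, the vectors x ± (i/r)y are isotropic, with product 2x².
    refine ⟨.A02 0, by simp [commutativeList], algIso_of_triple hP _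
      (x := x + (Complex.I * r⁻¹) • y) (y := x - (Complex.I * r⁻¹) • y)
      (z := (2 : ℂ) • (x * x)) (fun p q s h => ?_) ?_ ?_ ?_ ?_ ?_ ?_ ?_ ?_ ?_⟩
    · have h1 := hli (p + q) (2 * s) ((p - q) * (Complex.I * r⁻¹)) (by rw [← h]; module)
      simp only [mul_eq_zero, inv_eq_zero, hr, or_false, Complex.I_ne_zero, OfNat.ofNat_ne_zero,
        false_or] at h1
      exact ⟨by linear_combination (h1.1 + h1.2.2) / 2, by linear_combination (h1.1 - h1.2.2) / 2,
        h1.2.1⟩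
    all_goals
      simp only [add_mul, mul_add, sub_mul, mul_sub, smul_mul_assoc, mul_smul_comm, hann, hxyz,
        hxy, hyx, hc, smul_zero, smul_smul, mul_zero, zero_mul, add_zero, sub_zero, zero_add]
      simp [table, e₁, e₂, e₃]
    all_goals
      match_scalars
      field_simp
      rw [Complex.I_sq]
      norm_num

/-- Classification of commutative associative algebras of dimension three. -/
theorem exists_commutativeList (hP : Module.finrank ℂ P = 3) :
    ∃ N ∈ commutativeList, AlgIso P (Alg N) := by
  have : FiniteDimensional ℂ P := Module.finite_of_finrank_eq_succ hP
  by_cases hnil : ∀ x : P, IsNilpotent (LinearMap.mulLeft ℂ x)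
  · exact exists_commutativeList_of_nil hP hnil
  push Not at hnil
  obtain ⟨x, hx⟩ := hnil
  obtain ⟨w, he0, he⟩ := exists_idempotent_of_not_isNilpotent hx
  by_cases hid : ∀ f : P, f * f = f → f ≠ 0 → ∀ x, f * x = 0 → x = 0
  · refine exists_commutativeList_of_local hP he0 (fun y => ?_) hid
    refine sub_eq_zero.1 (hid _ he he0 _ ?_)
    rw [mul_sub, ← mul_assoc, he, sub_self]
  · push Not at hid
    obtain ⟨f, hf, hf0, y, hy, hy0⟩ := hid
    have h1 := LinearMap.finrank_range_add_finrank_ker (LinearMap.mulLeft ℂ f)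
    have h2 : 0 < Module.finrank ℂ (LinearMap.range (LinearMap.mulLeft ℂ f)) := by
      have : Nontrivial (LinearMap.range (LinearMap.mulLeft ℂ f)) :=
        ⟨⟨f, ⟨f, hf⟩⟩, 0, fun h => hf0 (congrArg Subtype.val h)⟩
      exact Module.finrank_pos
    have h3 : 0 < Module.finrank ℂ (LinearMap.ker (LinearMap.mulLeft ℂ f)) := by
      have : Nontrivial (LinearMap.ker (LinearMap.mulLeft ℂ f)) :=
        ⟨⟨y, hy⟩, 0, fun h => hy0 (congrArg Subtype.val h)⟩
      exact Module.finrank_pos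
    have h4 : Module.finrank ℂ (LinearMap.ker (LinearMap.mulLeft ℂ f)) = 1 ∨
        Module.finrank ℂ (LinearMap.ker (LinearMap.mulLeft ℂ f)) = 2 := by omega
    rcases h4 with h4 | h4
    · exact exists_commutativeList_of_finrank_ker_eq_one hP hf h4
    · exact exists_commutativeList_of_finrank_ker_eq_two hP hf hf0 h4

end CommAlgebraClassification

/-! ### Anticommutative algebras and congruence of matrices -/

open Matrix in
/-- The anticommutative multiplication table with `e₂e₃`, `e₃e₁`, `e₁e₂` given by the columns
of a matrix. -/
def antiTable (M : Matrix (Fin 3) (Fin 3) ℂ) : MulTable :=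
  !![0, Mᵀ 2, -Mᵀ 1;
     -Mᵀ 2, 0, Mᵀ 0;
     Mᵀ 1, -Mᵀ 0, 0]

/-- Congruence of matrices up to a nonzero scalar. -/
def ProjCongr (M M' : Matrix (Fin 3) (Fin 3) ℂ) : Prop :=
  ∃ (G : Matrix (Fin 3) (Fin 3) ℂ) (c : ℂ), G.det ≠ 0 ∧ c ≠ 0 ∧ G * M * G.transpose = c • M'

theorem ProjCongr.trans {M M' M'' : Matrix (Fin 3) (Fin 3) ℂ} (h : ProjCongr M M')
    (h' : ProjCongr M' M'') : ProjCongr M M'' := by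
  obtain ⟨G, c, hG, hc, h⟩ := h
  obtain ⟨G', c', hG', hc', h'⟩ := h'
  refine ⟨G' * G, c * c', by rw [Matrix.det_mul]; exact mul_ne_zero hG' hG, mul_ne_zero hc hc', ?_⟩
  calc G' * G * M * (G' * G).transpose = G' * (G * M * G.transpose) * G'.transpose := by
        rw [Matrix.transpose_mul]; simp only [Matrix.mul_assoc]
    _ = (c * c') • M'' := by
        rw [h, Matrix.mul_smul, Matrix.smul_mul, h', smul_smul]

namespace TableAlgebra

theorem antiTable_mul_coord {M : Matrix (Fin 3) (Fin 3) ℂ} (x y : TableAlgebra (antiTable M))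
    (k : Fin 3) : (x * y).coord k = M k 0 * (x.coord 1 * y.coord 2 - x.coord 2 * y.coord 1) +
      M k 1 * (x.coord 2 * y.coord 0 - x.coord 0 * y.coord 2) +
      M k 2 * (x.coord 0 * y.coord 1 - x.coord 1 * y.coord 0) := by
  rw [mul_coord]
  simp only [Fin.sum_univ_three]
  generalize x.coord = x
  generalize y.coord = y
  simp [antiTable]
  ring

/-- The element of a table algebra given by a column of a matrix. -/
def col (t : MulTable) (G : Matrix (Fin 3) (Fin 3) ℂ) (i : Fin 3) : TableAlgebra t :=
  ofCoord t fun k => G k i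

theorem col_coord (t : MulTable) (G : Matrix (Fin 3) (Fin 3) ℂ) (i k : Fin 3) :
    (col t G i).coord k = G k i := rfl

/-- The product is M(x × y), and Gx × Gy = (adj G)ᵀ(x × y). Comparing G(M(x × y)) with M'(Gx × Gy)
on basis vectors gives the matrix equation. -/
theorem col_mul_iff (M M' G : Matrix (Fin 3) (Fin 3) ℂ) :
    (∀ i j, col (antiTable M') G i * col (antiTable M') G j =
      antiTable M i j 0 • col (antiTable M') G 0 + antiTable M i j 1 • col (antiTable M') G 1 +
        antiTable M i j 2 • col (antiTable M') G 2) ↔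
      G * M = M' * G.adjugate.transpose := by
  constructor
  · intro h
    ext k j
    have h12 := congrArg (fun x => x.coord k) (h 1 2)
    have h20 := congrArg (fun x => x.coord k) (h 2 0)
    have h01 := congrArg (fun x => x.coord k) (h 0 1)
    simp only [antiTable_mul_coord, add_coord, smul_coord, col_coord] at h12 h20 h01
    simp only [Matrix.mul_apply, Fin.sum_univ_three, Matrix.adjugate_fin_three,
      Matrix.transpose_apply]
    simp [antiTable] at h12 h20 h01
    fin_cases j <;> simp
    · linear_combination -h12
    · linear_combination -h20
    · linear_combination -h01
  · intro h i j
    refine ext_coord fun k => ?_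
    have h0 := congrFun (congrFun h k) 0
    have h1 := congrFun (congrFun h k) 1
    have h2 := congrFun (congrFun h k) 2
    simp only [antiTable_mul_coord, add_coord, smul_coord, col_coord]
    simp only [Matrix.mul_apply, Fin.sum_univ_three, Matrix.adjugate_fin_three,
      Matrix.transpose_apply] at h0 h1 h2
    simp at h0 h1 h2
    fin_cases i <;> fin_cases j <;> simp [antiTable]
    · ring
    · linear_combination -h2
    · linear_combination h1
    · linear_combination h2
    · ring
    · linear_combination -h0
    · linear_combination -h1
    · linear_combination h0
    · ring

end TableAlgebra

open TableAlgebra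

/-- An isomorphism needs GMGᵀ = det(G)M'. An arbitrary scalar c is allowed because replacing G by μG
multiplies the left side by μ² and the determinant by μ³. -/
theorem ProjCongr.algIso {M M' : Matrix (Fin 3) (Fin 3) ℂ} (h : ProjCongr M M') :
    AlgIso (TableAlgebra (antiTable M)) (TableAlgebra (antiTable M')) := by
  obtain ⟨G, c, hG, hc, h⟩ := h
  set μ := c / G.det with hμ
  have hμ0 : μ ≠ 0 := div_ne_zero hc hG
  have h1 : (μ • G) * M = M' * (μ • G).adjugate.transpose := by
    have h2 : c • (M' * G.adjugate.transpose) = G.det • (G * M) := by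
      rw [← Matrix.smul_mul, ← h, Matrix.mul_assoc, ← Matrix.transpose_mul, Matrix.adjugate_mul,
        Matrix.transpose_smul, Matrix.transpose_one, Matrix.mul_smul, Matrix.mul_one]
    have h3 : G * M = μ • (M' * G.adjugate.transpose) := by
      rw [hμ, div_eq_inv_mul, mul_smul, h2, smul_smul, inv_mul_cancel₀ hG, one_smul]
    rw [Matrix.adjugate_smul, Matrix.transpose_smul, Matrix.mul_smul, Matrix.smul_mul, h3, smul_smul]
    simp [pow_two]
  rw [← col_mul_iff] at h1
  refine AlgIso.symm (algIso_of_triple (finrank_eq _) _ (x := col _ (μ • G) 0)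
    (y := col _ (μ • G) 1) (z := col _ (μ • G) 2) (fun p q r hpqr => ?_) (h1 0 0) (h1 0 1) (h1 0 2)
    (h1 1 0) (h1 1 1) (h1 1 2) (h1 2 0) (h1 2 1) (h1 2 2))
  have h0 : (μ • G).mulVec ![p, q, r] = 0 := by
    funext k
    have := congrArg (fun x => x.coord k) hpqr
    simp only [add_coord, smul_coord, col_coord, zero_coord] at this
    simp only [Matrix.mulVec, dotProduct, Fin.sum_univ_three, Pi.zero_apply]
    rw [← this]
    simp
    ring
  have hdet : (μ • G).det ≠ 0 := by
    rw [Matrix.det_smul]; exact mul_ne_zero (pow_ne_zero _ hμ0) hG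
  have h4 := Matrix.eq_zero_of_mulVec_eq_zero hdet h0
  exact ⟨congrFun h4 0, congrFun h4 1, congrFun h4 2⟩

/-- Multiplying the relation of `col_mul_iff` on the right by Gᵀ turns the adjugate into the scalar
det G. -/
theorem AlgIso.projCongr {M M' : Matrix (Fin 3) (Fin 3) ℂ}
    (h : AlgIso (TableAlgebra (antiTable M)) (TableAlgebra (antiTable M'))) :
    ProjCongr M M' := by
  obtain ⟨b, hb⟩ := exists_basis_of_algIso h.symm
  let G : Matrix (Fin 3) (Fin 3) ℂ := Matrix.of fun k i => (b i).coord k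
  have hcol : ∀ i, b i = col (antiTable M') G i := fun i => rfl
  have h1 : G * M = M' * G.adjugate.transpose := by
    rw [← col_mul_iff]
    intro i j
    simp only [← hcol, hb, Fin.sum_univ_three]
  have hdet : G.det ≠ 0 := by
    have : G = (basis (antiTable M')).toMatrix b := by
      ext k i
      rw [Module.Basis.toMatrix_apply, basis]
      rfl
    rw [this, ← Module.Basis.det_apply]
    exact ((basis (antiTable M')).isUnit_det b).ne_zero
  refine ⟨G, G.det, hdet, hdet, ?_⟩
  rw [h1, Matrix.mul_assoc, ← Matrix.transpose_mul, Matrix.mul_adjugate,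
        Matrix.transpose_smul, Matrix.transpose_one, Matrix.mul_smul, Matrix.mul_one]

/-- Every anticommutative algebra of dimension three is given by a matrix. -/
theorem exists_algIso_antiTable {K : Type*} [NonUnitalNonAssocRing K] [Module ℂ K]
    [IsScalarTower ℂ K K] [SMulCommClass ℂ K K] (hK : Module.finrank ℂ K = 3)
    (h : ∀ x y : K, x * y = -(y * x)) : ∃ M, AlgIso K (TableAlgebra (antiTable M)) := by
  have : FiniteDimensional ℂ K := Module.finite_of_finrank_eq_succ hK
  let b := Module.finBasisOfFinrankEq ℂ K hK
  have h0 : ∀ x : K, x * x = 0 := fun x => by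
    have h1 := h x x
    rw [eq_neg_iff_add_eq_zero, ← two_smul ℂ] at h1
    simpa using h1
  refine ⟨!![b.repr (b 1 * b 2) 0, b.repr (b 2 * b 0) 0, b.repr (b 0 * b 1) 0;
    b.repr (b 1 * b 2) 1, b.repr (b 2 * b 0) 1, b.repr (b 0 * b 1) 1;
    b.repr (b 1 * b 2) 2, b.repr (b 2 * b 0) 2, b.repr (b 0 * b 1) 2],
    algIso_of_basis _ b fun i j => ?_⟩
  have h12 := b.sum_repr (b 1 * b 2)
  have h20 := b.sum_repr (b 2 * b 0)
  have h01 := b.sum_repr (b 0 * b 1)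
  rw [Fin.sum_univ_three] at h12 h20 h01 ⊢
  fin_cases i <;> fin_cases j <;> simp [antiTable, h0]
  · exact h01.symm
  · linear_combination (norm := module) (1 : ℂ) • h20 + h _ _
  · linear_combination (norm := module) (1 : ℂ) • h01 + h _ _
  · exact h12.symm
  · exact h20.symm
  · linear_combination (norm := module) (1 : ℂ) • h12 + h _ _

namespace Kokoris

/-- The matrix of an anticommutative algebra of the list. -/
def antiForm : Name → Matrix (Fin 3) (Fin 3) ℂ
  | .A20 => !![1, 0, 0; 0, 0, 0; 0, 0, 0]
  | .A21 => !![0, -1, 0; 1, 0, 0; 0, 0, 0]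
  | .A22 α => !![0, -1, 0; α, -1, 0; 0, 0, 0]
  | .A23 => !![1, 0, 0; 0, 1, 0; 0, 0, 1]
  | .A24 α => !![0, -1, 0; α, 0, 0; 0, -1, 1]
  | .A25 => !![0, 0, 1; 1, 0, 0; 0, 0, 0]
  | .A26 => !![0, -1, 0; 1, 0, 0; 0, 0, 1]
  | _ => !![0, 0, 0; 0, 0, 0; 0, 0, 0]

theorem table_eq_antiTable {N : Name} (hN : N ∈ anticommutativeList) :
    table N = antiTable (antiForm N) := by
  simp only [anticommutativeList, Set.mem_union, Set.mem_insert_iff, Set.mem_singleton_iff,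
    Set.mem_range] at hN
  rcases hN with ((rfl | rfl | rfl | rfl | rfl | rfl) | ⟨α, rfl⟩) | ⟨α, rfl⟩
  all_goals
    ext i j k
    fin_cases i <;> fin_cases j <;> fin_cases k <;> simp [table, antiTable, antiForm, e₁, e₂, e₃]

theorem algIso_iff_projCongr {M N : Name} (hM : M ∈ anticommutativeList)
    (hN : N ∈ anticommutativeList) :
    AlgIso (Alg M) (Alg N) ↔ ProjCongr (antiForm M) (antiForm N) := by
  unfold Alg
  rw [table_eq_antiTable hM, table_eq_antiTable hN]
  exact ⟨AlgIso.projCongr, ProjCongr.algIso⟩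

end Kokoris

/-! ### Congruence classes of complex bilinear forms of rank three -/

namespace Kokoris

set_option linter.unusedSimpArgs false

/-- A bilinear form is congruent, up to a scalar, to one of the anticommutative list. -/
def IsListed (M : Matrix (Fin 3) (Fin 3) ℂ) : Prop :=
  ∃ N ∈ anticommutativeList, ProjCongr M (antiForm N)

theorem IsListed.of_projCongr {M M' : Matrix (Fin 3) (Fin 3) ℂ} (h : ProjCongr M M')
    (h' : IsListed M') : IsListed M := by
  obtain ⟨N, hN, h'⟩ := h'
  exact ⟨N, hN, h.trans h'⟩

/-- A change of basis, with the Gram matrix given entrywise. -/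
theorem projCongr_of_gram (M M' : Matrix (Fin 3) (Fin 3) ℂ) (x y z : Fin 3 → ℂ) {c : ℂ}
    (hc : c ≠ 0)
    (hdet : x 0 * (y 1 * z 2 - y 2 * z 1) - x 1 * (y 0 * z 2 - y 2 * z 0) +
      x 2 * (y 0 * z 1 - y 1 * z 0) ≠ 0)
    (h : ∀ i j, ∑ k, ∑ l, (![x, y, z] i k) * M k l * (![x, y, z] j l) = c * M' i j) :
    ProjCongr M M' := by
  refine ⟨Matrix.of ![x, y, z], c, ?_, hc, ?_⟩
  · rw [Matrix.det_fin_three]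
    simp only [Matrix.of_apply, Matrix.cons_val]
    convert hdet using 1
    ring
  · ext i j
    rw [Matrix.smul_apply, smul_eq_mul, ← h i j]
    simp only [Matrix.mul_apply, Matrix.transpose_apply, Matrix.of_apply, Finset.sum_mul]
    exact Finset.sum_comm

/-- Every nonzero vector is the first row of an invertible matrix. -/
theorem exists_projCongr_first (M : Matrix (Fin 3) (Fin 3) ℂ) {k : Fin 3 → ℂ} (hk : k ≠ 0) :
    ∃ y z : Fin 3 → ℂ, ProjCongr M (Matrix.of fun i j =>
      ∑ p, ∑ q, (![k, y, z] i p) * M p q * (![k, y, z] j q)) := by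
  have h : k 0 ≠ 0 ∨ k 1 ≠ 0 ∨ k 2 ≠ 0 := by
    by_contra! h
    apply hk
    funext i
    fin_cases i
    exacts [h.1, h.2.1, h.2.2]
  rcases h with h | h | h
  · refine ⟨![0, 1, 0], ![0, 0, 1], projCongr_of_gram _ _ k ![0, 1, 0] ![0, 0, 1] one_ne_zero ?_ fun i j => ?_⟩
    · simpa using h
    · rw [one_mul]; rfl
  · refine ⟨![1, 0, 0], ![0, 0, 1], projCongr_of_gram _ _ k ![1, 0, 0] ![0, 0, 1] one_ne_zero ?_ fun i j => ?_⟩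
    · simpa using h
    · rw [one_mul]; rfl
  · refine ⟨![1, 0, 0], ![0, 1, 0], projCongr_of_gram _ _ k ![1, 0, 0] ![0, 1, 0] one_ne_zero ?_ fun i j => ?_⟩
    · simpa using h
    · rw [one_mul]; rfl

/-- A nonzero value on the first vector splits off, if the form is symmetric there. -/
theorem projCongr_split {a b c d e f g : ℂ} (ha : a ≠ 0) :
    ∃ d' e' f' g', e' - f' = a * a * (e - f) ∧
      ProjCongr !![a, b, c; b, d, e; c, f, g] !![a, 0, 0; 0, d', e'; 0, f', g'] := by
  -- Gram–Schmidt against the first vector, with the denominator a cleared.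
  refine ⟨a * a * d - a * b * b, a * a * e - a * b * c, a * a * f - a * b * c,
    a * a * g - a * c * c, by ring,
    projCongr_of_gram _ _ ![1, 0, 0] ![-b, a, 0] ![-c, 0, a] one_ne_zero (by simp [ha]) ?_⟩
  intro i j
  fin_cases i <;> fin_cases j <;> simp [Fin.sum_univ_three] <;> ring

/-- A plane contains an isotropic vector. -/
theorem projCongr_isotropic (a d e f g : ℂ) :
    ∃ e' f' g', (e' - f' = e - f ∨ e' - f' = f - e) ∧
      ProjCongr !![a, 0, 0; 0, d, e; 0, f, g] !![a, 0, 0; 0, 0, e'; 0, f', g'] := by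
  by_cases hd : d = 0
  · subst hd
    refine ⟨e, f, g, Or.inl rfl, projCongr_of_gram _ _ ![1, 0, 0] ![0, 1, 0] ![0, 0, 1] one_ne_zero
      (by simp) ?_⟩
    intro i j
    fin_cases i <;> fin_cases j <;> simp [Fin.sum_univ_three]
  · obtain ⟨s, hs⟩ := IsAlgClosed.exists_eq_mul_self ((e + f) ^ 2 - 4 * d * g)
    -- A root of dx² + (e + f)x + g, so that (0, x, 1) is isotropic. Taking it before (0, 1, 0)
    -- changes the sign of the skew part.
    set x := (-(e + f) + s) / (2 * d) with hx
    have hx0 : d * x * x + (e + f) * x + g = 0 := by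
      rw [hx]; field_simp; linear_combination -hs
    refine ⟨x * d + f, x * d + e, d, Or.inr (by ring),
      projCongr_of_gram _ _ ![1, 0, 0] ![0, x, 1] ![0, 1, 0] one_ne_zero (by simp) ?_⟩
    intro i j
    fin_cases i <;> fin_cases j <;> simp [Fin.sum_univ_three]
    · linear_combination hx0
    · ring

/-- Normal form of a non-symmetric form on a plane. -/
theorem projCongr_plane (a : ℂ) {d e f g : ℂ} (hef : e ≠ f) :
    ∃ p q r, p ≠ q ∧ p ≠ 0 ∧ (r = 0 ∨ (p + q = 0 ∧ r ≠ 0)) ∧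
      ProjCongr !![a, 0, 0; 0, d, e; 0, f, g] !![a, 0, 0; 0, 0, p; 0, q, r] := by
  obtain ⟨p, q, r, h, hc⟩ := projCongr_isotropic a d e f g
  have hpq : p ≠ q := by
    rintro rfl
    rcases h with h | h
    · exact hef (by linear_combination -h)
    · exact hef (by linear_combination h)
  by_cases hs : p + q = 0
  · refine ⟨p, q, r, hpq, ?_, ?_, hc⟩
    · rintro rfl; exact hpq (by linear_combination -hs)
    · by_cases hr : r = 0
      · exact Or.inl hr
      · exact Or.inr ⟨hs, hr⟩
  · have h0 : ProjCongr !![a, 0, 0; 0, 0, p; 0, q, r] !![a, 0, 0; 0, 0, p; 0, q, 0] := by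
      -- A nonzero symmetric part p + q lets a multiple of the isotropic vector absorb r.
      refine projCongr_of_gram _ _ ![1, 0, 0] ![0, 1, 0] ![0, -r / (p + q), 1] one_ne_zero
        (by simp) ?_
      intro i j
      fin_cases i <;> fin_cases j <;> simp [Fin.sum_univ_three]
      field_simp
      ring
    by_cases hp : p = 0
    · subst hp
      refine ⟨q, 0, 0, hpq.symm, hpq.symm, Or.inl rfl, hc.trans (h0.trans ?_)⟩
      refine projCongr_of_gram _ _ ![1, 0, 0] ![0, 0, 1] ![0, 1, 0] one_ne_zero (by simp) ?_
      intro i j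
      fin_cases i <;> fin_cases j <;> simp [Fin.sum_univ_three]
    · exact ⟨p, q, 0, hpq, hp, Or.inl rfl, hc.trans h0⟩

/-- The form lives on a plane and is not symmetric there. It is skew (`A21`), or has two isotropic
lines with values p, q in the two orders (`A22 (-q / p)`), or is skew plus a nonzero square (`A22
1`). -/
theorem isListed_of_radical {d e f g : ℂ} (hef : e ≠ f) :
    IsListed !![0, 0, 0; 0, d, e; 0, f, g] := by
  obtain ⟨p, q, r, hpq, hp, h, hc⟩ := projCongr_plane 0 (d := d) (g := g) hef
  refine IsListed.of_projCongr hc ?_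
  rcases h with rfl | ⟨hs, hr⟩
  · by_cases hs : p + q = 0
    · obtain rfl : q = -p := by linear_combination hs
      refine ⟨.A21, by simp [anticommutativeList], projCongr_of_gram _ _ ![0, 1, 0] ![0, 0, 1]
        ![1, 0, 0] (neg_ne_zero.2 hp) (by simp) ?_⟩
      intro i j
      fin_cases i <;> fin_cases j <;> simp [Fin.sum_univ_three, antiForm]
    -- The shift p/(p + q) makes the second vector have value p on itself.
    · refine ⟨.A22 (-q / p), by simp [anticommutativeList], projCongr_of_gram _ _ ![0, 1, 0]
        ![0, p / (p + q), 1] ![1, 0, 0] (neg_ne_zero.2 hp) (by simp) ?_⟩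
      intro i j
      fin_cases i <;> fin_cases j <;> simp [Fin.sum_univ_three, antiForm] <;> field_simp
  · obtain rfl : q = -p := by linear_combination hs
    refine ⟨.A22 1, by simp [anticommutativeList], projCongr_of_gram _ _ ![0, r / p, 0]
      ![0, 0, 1] ![1, 0, 0] (neg_ne_zero.2 hr) (by simp [hr, hp]) ?_⟩
    intro i j
    fin_cases i <;> fin_cases j <;> simp [Fin.sum_univ_three, antiForm] <;> field_simp

/-- Two isotropic vectors are adapted to the zero diagonal entries of `A24`; only the ratio of p and
q survives the scaling. The condition p + q ≠ 0 makes the middle row correctable to an isotropic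
vector. -/
theorem projCongr_A24 {a p q : ℂ} (ha : a ≠ 0) (hp : p ≠ 0) (hpq : p ≠ q) (hs : p + q ≠ 0) :
    ProjCongr !![a, 0, 0; 0, 0, p; 0, q, 0] (antiForm (.A24 (-q / p))) := by
  have hpq' : p - q ≠ 0 := sub_ne_zero.2 hpq
  refine projCongr_of_gram _ _ ![0, -a / p, 0]
    ![q / (p - q), -(a * q ^ 2 / (p - q) ^ 2) / (p + q), 1] ![1, -a / (p - q), 0] ha ?_ ?_
  · simp [ha, hp]
  intro i j
  fin_cases i <;> fin_cases j <;> simp [Fin.sum_univ_three, antiForm] <;> field_simp <;> ring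

theorem isListed_of_anisotropic_kernel {a d e f g : ℂ} (ha : a ≠ 0) (hef : e ≠ f) :
    IsListed !![a, 0, 0; 0, d, e; 0, f, g] := by
  obtain ⟨p, q, r, hpq, hp, h, hc⟩ := projCongr_plane a (d := d) (g := g) hef
  refine IsListed.of_projCongr hc ?_
  rcases h with rfl | ⟨hs, hr⟩
  · by_cases hs : p + q = 0
    · obtain rfl : q = -p := by linear_combination hs
      refine ⟨.A26, by simp [anticommutativeList], projCongr_of_gram _ _ ![0, -a / p, 0] ![0, 0, 1]
        ![1, 0, 0] ha (by simp [ha, hp]) ?_⟩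
      intro i j
      fin_cases i <;> fin_cases j <;> simp [Fin.sum_univ_three, antiForm] <;> field_simp
    · exact ⟨.A24 (-q / p), by simp [anticommutativeList], projCongr_A24 ha hp hpq hs⟩
  · obtain rfl : q = -p := by linear_combination hs
    -- Chosen so that (−1/2, 0, l) is isotropic: a/4 + rl² = 0.
    obtain ⟨l, hl⟩ := IsAlgClosed.exists_eq_mul_self (-a / (4 * r))
    have hl' : 4 * r * l ^ 2 = -a := by
      rw [pow_two, ← hl]; field_simp
    have hl0 : l ≠ 0 := by
      rintro rfl
      apply ha
      linear_combination hl'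
    refine ⟨.A24 1, by simp [anticommutativeList], projCongr_of_gram _ _ ![0, -a / (p * l), 0]
        ![-1 / 2, 0, l] ![1, -a / (2 * p * l), 0] ha ?_ ?_⟩
    · simp [ha, hp, hl0]
    intro i j
    fin_cases i <;> fin_cases j <;> simp [Fin.sum_univ_three, antiForm] <;> field_simp
    · linear_combination hl'
    · ring
    · ring

/-- The kernel of the skew part is isotropic, but not in the radical. -/
theorem isListed_of_isotropic_kernel {b c d e f g : ℂ} (hbc : b ≠ 0 ∨ c ≠ 0) (hef : e ≠ f) :
    IsListed !![0, b, c; b, d, e; c, f, g] := by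
  wlog hc : c ≠ 0 generalizing b c d e f g
  · have hb : b ≠ 0 := by tauto
    refine IsListed.of_projCongr ?_ (this (b := c) (c := b) (d := g) (e := f) (f := e) (g := d)
      (Or.inr hb) hef.symm hb)
    refine projCongr_of_gram _ _ ![1, 0, 0] ![0, 0, 1] ![0, 1, 0] one_ne_zero (by simp) ?_
    intro i j
    fin_cases i <;> fin_cases j <;> simp [Fin.sum_univ_three]
  -- The first vector pairs symmetrically with the third by c ≠ 0. After the third vector clears b,
  -- multiples of the first remove the symmetric part of the off-diagonal block and the last
  -- diagonal entry.
  obtain ⟨δ, h, hh, hc'⟩ : ∃ δ h : ℂ, h ≠ 0 ∧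
      ProjCongr !![0, b, c; b, d, e; c, f, g] !![0, 0, c; 0, δ, h; c, -h, 0] := by
    have h1 : ProjCongr !![0, b, c; b, d, e; c, f, g]
        !![0, 0, c; 0, d - b * (e + f) / c + b ^ 2 * g / c ^ 2, e - b * g / c;
          c, f - b * g / c, g] := by
      refine projCongr_of_gram _ _ ![1, 0, 0] ![0, 1, -b / c] ![0, 0, 1] one_ne_zero (by simp) ?_
      intro i j
      fin_cases i <;> fin_cases j <;> simp [Fin.sum_univ_three] <;> field_simp <;> ring
    refine ⟨d - b * (e + f) / c + b ^ 2 * g / c ^ 2, (e - f) / 2, div_ne_zero (sub_ne_zero.2 hef) two_ne_zero, h1.trans ?_⟩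
    refine projCongr_of_gram _ _ ![1, 0, 0] ![-(e + f - 2 * b * g / c) / (2 * c), 1, 0]
      ![-g / (2 * c), 0, 1] one_ne_zero (by simp) ?_
    intro i j
    fin_cases i <;> fin_cases j <;> simp [Fin.sum_univ_three] <;> field_simp <;> ring
  refine IsListed.of_projCongr hc' ?_
  by_cases hd : δ = 0
  · subst hd
    refine ⟨.A25, by simp [anticommutativeList], projCongr_of_gram _ _ ![0, 0, 1] ![h / c, 1, 0]
      ![h / c, -1, 0] (mul_ne_zero two_ne_zero hh) ?_ ?_⟩
    · have : -h / c - h / c ≠ 0 := by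
        rw [show -h / c - h / c = -2 * h / c by ring]
        simp [hh, hc]
      simpa [neg_div] using this
    intro i j
    fin_cases i <;> fin_cases j <;> simp [Fin.sum_univ_three, antiForm] <;> field_simp <;> ring
  · refine ⟨.A24 (-1), by simp [anticommutativeList], projCongr_of_gram _ _ ![2 * h / c, 0, 0]
      ![0, 0, -δ / (2 * h)] ![h / c, 1, 0] hd (by simp [hh, hc, hd]) ?_⟩
    intro i j
    fin_cases i <;> fin_cases j <;> simp [Fin.sum_univ_three, antiForm] <;> field_simp <;> ring

/-- A nonzero skew form in dimension three has a one-dimensional kernel ℂk. With k as first basis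
vector the first row equals the first column, and the cases are: k non-isotropic, k in the radical,
k isotropic but outside the radical. -/
theorem isListed_of_not_symmetric {M : Matrix (Fin 3) (Fin 3) ℂ} (hM : M.transpose ≠ M) :
    IsListed M := by
  -- The axial vector of the skew part M − Mᵀ, which spans its kernel.
  set k : Fin 3 → ℂ := ![M 1 2 - M 2 1, M 2 0 - M 0 2, M 0 1 - M 1 0] with hk
  have hk0 : k ≠ 0 := by
    intro h0
    apply hM
    have h1 := congrFun h0 0
    have h2 := congrFun h0 1
    have h3 := congrFun h0 2
    simp [hk] at h1 h2 h3
    ext i j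
    fin_cases i <;> fin_cases j <;> simp
    · linear_combination -h3
    · linear_combination h2
    · linear_combination h3
    · linear_combination -h1
    · linear_combination -h2
    · linear_combination h1
  obtain ⟨y, z, hc⟩ := exists_projCongr_first M hk0
  refine IsListed.of_projCongr hc ?_
  set M' : Matrix (Fin 3) (Fin 3) ℂ := Matrix.of fun i j =>
      ∑ p, ∑ q, (![k, y, z] i p) * M p q * (![k, y, z] j q) with hM'
  have h01 : M' 1 0 = M' 0 1 := by
    simp [hM', hk, Fin.sum_univ_three]; ring
  have h02 : M' 2 0 = M' 0 2 := by
    simp [hM', hk, Fin.sum_univ_three]; ring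
  have h12 : M' 1 2 ≠ M' 2 1 := by
    intro h12
    obtain ⟨G, c, hG, hc0, h⟩ := hc
    apply hM
    have hs : M'.transpose = M' := by
      ext i j
      fin_cases i <;> fin_cases j <;> simp [h01, h02, h12]
    have h1 : G * M.transpose * G.transpose = G * M * G.transpose := by
      have := congrArg Matrix.transpose h
      rw [Matrix.transpose_mul, Matrix.transpose_mul, Matrix.transpose_transpose,
        Matrix.transpose_smul, hs, ← h, ← Matrix.mul_assoc] at this
      exact this
    have hGu : IsUnit G := (Matrix.isUnit_iff_isUnit_det _).2 hG.isUnit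
    have hGu' : IsUnit G.transpose := (Matrix.isUnit_iff_isUnit_det _).2 (by
      rw [Matrix.det_transpose]; exact hG.isUnit)
    exact hGu.mul_left_cancel (hGu'.mul_right_cancel h1)
  have hM'' : M' = !![M' 0 0, M' 0 1, M' 0 2; M' 0 1, M' 1 1, M' 1 2; M' 0 2, M' 2 1, M' 2 2] := by
    ext i j
    fin_cases i <;> fin_cases j <;> simp [h01, h02]
  clear_value M'
  rw [hM'']
  by_cases ha : M' 0 0 = 0
  · rw [ha]
    by_cases hbc : M' 0 1 ≠ 0 ∨ M' 0 2 ≠ 0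
    · exact isListed_of_isotropic_kernel hbc h12
    · push Not at hbc
      rw [hbc.1, hbc.2]
      exact isListed_of_radical h12
  · obtain ⟨d', e', f', g', h, hc⟩ := projCongr_split (b := M' 0 1) (c := M' 0 2) (d := M' 1 1)
      (e := M' 1 2) (f := M' 2 1) (g := M' 2 2) ha
    refine IsListed.of_projCongr hc (isListed_of_anisotropic_kernel ha ?_)
    rw [← sub_ne_zero, h]
    exact mul_ne_zero (mul_ne_zero ha ha) (sub_ne_zero.2 h12)

/-! ### Symmetric forms, classified by their rank. -/

theorem isListed_of_symmetric_split {a d e g : ℂ} (ha : a ≠ 0) :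
    IsListed !![a, 0, 0; 0, d, e; 0, e, g] := by
  obtain ⟨p, q, r, h, hc⟩ := projCongr_isotropic a d e e g
  obtain rfl : p = q := by rcases h with h | h <;> linear_combination h
  refine IsListed.of_projCongr hc ?_
  by_cases hp : p = 0
  · subst hp
    by_cases hr : r = 0
    · subst hr
      refine ⟨.A20, by simp [anticommutativeList], projCongr_of_gram _ _ ![1, 0, 0] ![0, 1, 0]
        ![0, 0, 1] ha (by simp) ?_⟩
      intro i j
      fin_cases i <;> fin_cases j <;> simp [Fin.sum_univ_three, antiForm]
    -- Rank two: as² = −r makes (s, 0, 1) isotropic, to match the zero first diagonal entry of `A22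
    -- (-1)`.
    · obtain ⟨s, hs⟩ := IsAlgClosed.exists_eq_mul_self (-r / a)
      have hs' : a * (s * s) = -r := by rw [← hs]; field_simp
      have hs0 : s ≠ 0 := by
        rintro rfl
        apply hr
        linear_combination hs'
      refine ⟨.A22 (-1), by simp [anticommutativeList], projCongr_of_gram _ _ ![s, 0, 1]
        ![s, 0, 0] ![0, 1, 0] hr (by simp [hs0]) ?_⟩
      intro i j
      fin_cases i <;> fin_cases j <;> simp [Fin.sum_univ_three, antiForm] <;>
        linear_combination hs'
  -- Rank three: with 2ps² = a, the last two rows below are orthogonal and have value a, so the form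
  -- becomes a times the identity.
  · obtain ⟨s, hs⟩ := IsAlgClosed.exists_eq_mul_self (a / (2 * p))
    have hs' : 2 * p * (s * s) = a := by rw [← hs]; field_simp
    have hs0 : s ≠ 0 := by
      rintro rfl
      apply ha
      linear_combination -hs'
    have hI := Complex.I_mul_I
    refine ⟨.A23, by simp [anticommutativeList], projCongr_of_gram _ _ ![1, 0, 0]
        ![0, s - s * r / (2 * p), s] ![0, Complex.I * (s + s * r / (2 * p)), -(Complex.I * s)]
        ha ?_ ?_⟩
    · have : -(2 * Complex.I * s * s) ≠ 0 := by simp [hs0]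
      convert this using 1
      simp
      ring
    intro i j
    fin_cases i <;> fin_cases j <;> simp [Fin.sum_univ_three, antiForm] <;> field_simp
    · linear_combination 2 * hs'
    · ring
    · ring
    · rw [Complex.I_sq]; linear_combination 2 * hs'

/-- Either the quadratic form vanishes, and with it the matrix by polarization, or a vector with
nonzero value splits off as an orthogonal summand. -/
theorem isListed_of_symmetric {M : Matrix (Fin 3) (Fin 3) ℂ} (hM : M.transpose = M) :
    IsListed M := by
  by_cases hq : ∀ u : Fin 3 → ℂ, ∑ p, ∑ q, u p * M p q * u q = 0
  · refine ⟨.A00, by simp [anticommutativeList], projCongr_of_gram _ _ ![1, 0, 0] ![0, 1, 0]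
      ![0, 0, 1] one_ne_zero (by simp) ?_⟩
    have h10 : M 1 0 = M 0 1 := congrFun (congrFun hM 0) 1
    have h20 : M 2 0 = M 0 2 := congrFun (congrFun hM 0) 2
    have h21 : M 2 1 = M 1 2 := congrFun (congrFun hM 1) 2
    have h1 := hq ![1, 0, 0]
    have h2 := hq ![0, 1, 0]
    have h3 := hq ![0, 0, 1]
    have h4 := hq ![1, 1, 0]
    have h5 := hq ![1, 0, 1]
    have h6 := hq ![0, 1, 1]
    simp [Fin.sum_univ_three] at h1 h2 h3 h4 h5 h6
    simp [h1, h2, h3, h10, h20, h21] at h4 h5 h6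
    intro i j
    fin_cases i <;> fin_cases j <;>
      simp [Fin.sum_univ_three, antiForm, h1, h2, h3, h4, h5, h6, h10, h20, h21]
  · push Not at hq
    obtain ⟨k, hk⟩ := hq
    have hk0 : k ≠ 0 := by
      rintro rfl
      simp at hk
    obtain ⟨y, z, hc⟩ := exists_projCongr_first M hk0
    refine IsListed.of_projCongr hc ?_
    set M' : Matrix (Fin 3) (Fin 3) ℂ := Matrix.of fun i j =>
      ∑ p, ∑ q, (![k, y, z] i p) * M p q * (![k, y, z] j q) with hM'
    have h00 : M' 0 0 ≠ 0 := hk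
    have hs : ∀ i j, M' i j = M' j i := by
      intro i j
      simp only [hM', Matrix.of_apply]
      rw [Finset.sum_comm]
      refine Finset.sum_congr rfl fun p _ => Finset.sum_congr rfl fun q _ => ?_
      rw [← congrFun (congrFun hM q) p, Matrix.transpose_apply]
      ring
    have hM'' : M' = !![M' 0 0, M' 0 1, M' 0 2; M' 0 1, M' 1 1, M' 1 2;
        M' 0 2, M' 1 2, M' 2 2] := by
      ext i j
      fin_cases i <;> fin_cases j <;> simp [hs 1 0, hs 2 0, hs 2 1]
    clear_value M'
    rw [hM'']
    obtain ⟨d', e', f', g', h, hc⟩ := projCongr_split (b := M' 0 1) (c := M' 0 2) (d := M' 1 1)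
      (e := M' 1 2) (f := M' 1 2) (g := M' 2 2) h00
    obtain rfl : e' = f' := by linear_combination h
    exact IsListed.of_projCongr hc (isListed_of_symmetric_split h00)

theorem isListed (M : Matrix (Fin 3) (Fin 3) ℂ) : IsListed M := by
  by_cases hM : M.transpose = M
  · exact isListed_of_symmetric hM
  · exact isListed_of_not_symmetric hM

/-- Classification of anticommutative algebras of dimension three. -/
theorem exists_anticommutativeList {K : Type*} [NonUnitalNonAssocRing K] [Module ℂ K]
    [IsScalarTower ℂ K K] [SMulCommClass ℂ K K] (hK : Module.finrank ℂ K = 3)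
    (h : ∀ x y : K, x * y = -(y * x)) : ∃ N ∈ anticommutativeList, AlgIso K (Alg N) := by
  obtain ⟨M, hM⟩ := exists_algIso_antiTable hK h
  obtain ⟨N, hN, hc⟩ := isListed M
  refine ⟨N, hN, hM.trans ?_⟩
  unfold Alg
  rw [table_eq_antiTable hN]
  exact hc.algIso

end Kokoris

/-! ### Classification of Kokoris algebras of dimension three -/

namespace Kokoris

section Classification

set_option linter.unusedSimpArgs false

variable {K : Type*} [NonUnitalNonAssocRing K] [Module ℂ K] [IsScalarTower ℂ K K]
  [SMulCommClass ℂ K K]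

/-- The bilinear map `(x, y) ↦ x y + y x`. -/
noncomputable def symMul (K : Type*) [NonUnitalNonAssocRing K] [Module ℂ K] [IsScalarTower ℂ K K]
    [SMulCommClass ℂ K K] : K →ₗ[ℂ] K →ₗ[ℂ] K :=
  LinearMap.mul ℂ K + (LinearMap.mul ℂ K).flip

/-- The commutator as a bilinear map. -/
noncomputable def commMul (K : Type*) [NonUnitalNonAssocRing K] [Module ℂ K] [IsScalarTower ℂ K K]
    [SMulCommClass ℂ K K] : K →ₗ[ℂ] K →ₗ[ℂ] K :=
  LinearMap.mul ℂ K - (LinearMap.mul ℂ K).flip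

theorem symMul_apply (x y : K) : symMul K x y = x * y + y * x := rfl

theorem commMul_apply (x y : K) : commMul K x y = x * y - y * x := rfl

theorem symMul_comm (x y : K) : symMul K x y = symMul K y x := add_comm _ _

theorem commMul_swap (x y : K) : commMul K x y = -commMul K y x := (neg_sub _ _).symm

theorem commMul_self (x : K) : commMul K x x = 0 := sub_self _

theorem mul_eq_symMul_add_commMul (x y : K) :
    x * y = (1 / 2 : ℂ) • (symMul K x y + commMul K x y) := by
  rw [symMul_apply, commMul_apply]; module

theorem commMul_symMul (hK : IsKokoris K) (x y z : K) :
    commMul K (symMul K x y) z = symMul K x (commMul K y z) + symMul K y (commMul K x z) :=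
  commutator_symm_mul hK.flexible x y z

/-- Commutators with an idempotent are fixed by the symmetrized product. -/
theorem symMul_commMul_of_idempotent (hK : IsKokoris K) {e : K} (he : symMul K e e = (2 : ℂ) • e)
    (w : K) : symMul K e (commMul K e w) = commMul K e w := by
  have h := commMul_symMul hK e e w
  rw [he, map_smul, LinearMap.smul_apply, ← two_smul ℂ] at h
  exact (smul_right_injective K (two_ne_zero (α := ℂ)) h).symm

omit [IsScalarTower ℂ K K] [SMulCommClass ℂ K K] in
theorem exists_coords (b : Module.Basis (Fin 3) ℂ K) (u : K) :
    ∃ p q r : ℂ, u = p • b 0 + q • b 1 + r • b 2 :=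
  ⟨b.repr u 0, b.repr u 1, b.repr u 2, by
    rw [← Fin.sum_univ_three (f := fun i => b.repr u i • b i), b.sum_repr]⟩

omit [IsScalarTower ℂ K K] [SMulCommClass ℂ K K] in
theorem coords_eq_zero (b : Module.Basis (Fin 3) ℂ K) (p q r : ℂ)
    (h : p • b 0 + q • b 1 + r • b 2 = 0) : p = 0 ∧ q = 0 ∧ r = 0 := by
  have h1 := Fintype.linearIndependent_iff.1 b.linearIndependent ![p, q, r]
    (by simpa [Fin.sum_univ_three] using h)
  exact ⟨h1 0, h1 1, h1 2⟩

theorem commutative_of_commMul_eq_zero (b : Module.Basis (Fin 3) ℂ K)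
    (h01 : commMul K (b 0) (b 1) = 0) (h02 : commMul K (b 0) (b 2) = 0)
    (h12 : commMul K (b 1) (b 2) = 0) (x y : K) : x * y = y * x := by
  have h : commMul K = 0 := by
    refine b.ext fun i => b.ext fun j => ?_
    rw [LinearMap.zero_apply, LinearMap.zero_apply]
    fin_cases i <;> fin_cases j <;> simp only [Fin.zero_eta, Fin.mk_one, Fin.reduceFinMk]
    exacts [commMul_self _, h01, h02, by rw [commMul_swap, h01, neg_zero], commMul_self _, h12,
      by rw [commMul_swap, h02, neg_zero], by rw [commMul_swap, h12, neg_zero], commMul_self _]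
  have := LinearMap.congr_fun (LinearMap.congr_fun h x) y
  exact sub_eq_zero.1 this

/-- The conclusion of the classification. -/
def IsClassified (K : Type*) [NonUnitalNonAssocRing K] [Module ℂ K] : Prop :=
  ((∀ x y : K, x * y = y * x) ∧ (∀ x y z : K, (x * y) * z = x * (y * z)) ∧
      ∃ N ∈ commutativeList, AlgIso K (Alg N)) ∨
    ((∀ x y : K, x * y = -(y * x)) ∧ ∃ N ∈ anticommutativeList, AlgIso K (Alg N)) ∨
    ∃ N ∈ properList, AlgIso K (Alg N)

theorem isClassified_of_commMul_eq_zero (hK : IsKokoris K) {N : Name} (hN : N ∈ commutativeList)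
    {b : Module.Basis (Fin 3) ℂ K}
    (hb : ∀ i j, b i * b j + b j * b i = (2 : ℂ) • ∑ k, table N i j k • b k)
    (h01 : commMul K (b 0) (b 1) = 0) (h02 : commMul K (b 0) (b 2) = 0)
    (h12 : commMul K (b 1) (b 2) = 0) : IsClassified K := by
  have hc := commutative_of_commMul_eq_zero b h01 h02 h12
  refine Or.inl ⟨hc, fun x y z => ?_, N, hN, algIso_of_basis _ b fun i j => ?_⟩
  · have hp : ∀ x y : K, plusMul x y = x * y := fun x y => by
      rw [plusMul, hc y x]; module
    simpa only [hp] using hK.plus_assoc x y z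
  · have := hb i j
    rw [hc (b j), ← two_smul ℂ] at this
    exact smul_right_injective K (two_ne_zero (α := ℂ)) this

variable (hK : IsKokoris K) {b : Module.Basis (Fin 3) ℂ K}

include hK

omit hK in
theorem isClassified_of_A00 (hfr : Module.finrank ℂ K = 3)
    (hb : ∀ i j, symMul K (b i) (b j) = (2 : ℂ) • ∑ k, table .A00 i j k • b k) :
    IsClassified K := by
  have h : symMul K = 0 := by
    refine b.ext fun i => b.ext fun j => ?_
    rw [hb]
    fin_cases i <;> fin_cases j <;> simp [table]
  have hc : ∀ x y : K, x * y = -(y * x) := fun x y =>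
    eq_neg_of_add_eq_zero_left (LinearMap.congr_fun (LinearMap.congr_fun h x) y)
  exact Or.inr (Or.inl ⟨hc, exists_anticommutativeList hfr hc⟩)

/-- The Leibniz rule makes e₂ = e₁∘e₁ central for the commutator and confines [e₁, e₃] to the span
of e₂ and e₃. A nonzero e₃-component leads to `A27`; otherwise a nonzero e₂-component leads to
`A28`. -/
theorem isClassified_of_A01 (hfr : Module.finrank ℂ K = 3)
    (hb : ∀ i j, symMul K (b i) (b j) = (2 : ℂ) • ∑ k, table .A01 i j k • b k) :
    IsClassified K := by
  have hli := coords_eq_zero b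
  obtain ⟨p, q, r, h02⟩ := exists_coords b (commMul K (b 0) (b 2))
  have s00 : symMul K (b 0) (b 0) = (2 : ℂ) • b 1 := by simp [hb, table, e₂, Fin.sum_univ_three]
  have s01 : symMul K (b 0) (b 1) = 0 := by simp [hb, table, e₂, Fin.sum_univ_three]
  have s02 : symMul K (b 0) (b 2) = 0 := by simp [hb, table, e₂, Fin.sum_univ_three]
  have s10 : symMul K (b 1) (b 0) = 0 := by simp [hb, table, e₂, Fin.sum_univ_three]
  have s11 : symMul K (b 1) (b 1) = 0 := by simp [hb, table, e₂, Fin.sum_univ_three]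
  have s12 : symMul K (b 1) (b 2) = 0 := by simp [hb, table, e₂, Fin.sum_univ_three]
  have s20 : symMul K (b 2) (b 0) = 0 := by simp [hb, table, e₂, Fin.sum_univ_three]
  have s21 : symMul K (b 2) (b 1) = 0 := by simp [hb, table, e₂, Fin.sum_univ_three]
  have s22 : symMul K (b 2) (b 2) = 0 := by simp [hb, table, e₂, Fin.sum_univ_three]
  have h20 := commMul_swap (b 2) (b 0)
  rw [h02] at h20
  have hp : p = 0 := by
    have h1 := commMul_symMul hK (b 0) (b 2) (b 0)
    rw [s02, h20, commMul_self] at h1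
    simp only [map_zero, map_neg, LinearMap.zero_apply, map_add, map_smul, s00, s01, s02] at h1
    have := (hli 0 (2 * p) 0 (by linear_combination (norm := module) h1)).2.1
    simpa using this
  subst hp
  have h10 : commMul K (b 1) (b 0) = 0 := by
    have h1 := commMul_symMul hK (b 0) (b 0) (b 0)
    rw [s00, commMul_self] at h1
    simpa using h1
  have h01 : commMul K (b 0) (b 1) = 0 := by rw [commMul_swap, h10, neg_zero]
  have h12 : commMul K (b 1) (b 2) = 0 := by
    have h1 := commMul_symMul hK (b 0) (b 0) (b 2)
    rw [s00, h02] at h1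
    simpa [s00, s01, s02] using h1
  have h21 : commMul K (b 2) (b 1) = 0 := by rw [commMul_swap, h12, neg_zero]
  by_cases hr : r = 0
  · subst hr
    by_cases hq : q = 0
    · subst hq
      exact isClassified_of_commMul_eq_zero hK (N := .A01) (by simp [commutativeList]) hb h01
        (by rw [h02]; module) h12
    · refine Or.inr (Or.inr ⟨.A28, by simp [properList], algIso_of_triple hfr _
        (x := b 0) (y := b 1) (z := (2 / q) • b 2) (fun k l m h => ?_) ?_ ?_ ?_ ?_ ?_ ?_ ?_ ?_ ?_⟩)
      · have := hli k l (m * (2 / q)) (by rw [← h]; module)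
        simpa [hq] using this
      all_goals
        simp only [mul_eq_symMul_add_commMul, map_smul, map_add, LinearMap.smul_apply,
          LinearMap.add_apply, s00, s01, s02, s10, s11, s12, s20, s21, s22, h01, h02, h10, h12, h20,
          h21, commMul_self]
        simp [table, e₁, e₂, e₃]
      all_goals (match_scalars; field_simp)
  -- The third vector is an eigenvector of the commutator with e₁, scaled so that [x, z] = 2z and
  -- hence xz = z.
  · refine Or.inr (Or.inr ⟨.A27, by simp [properList], algIso_of_triple hfr _
        (x := (2 / r) • b 0) (y := (4 / r ^ 2) • b 1) (z := b 2 + (q / r) • b 1)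
        (fun k l m h => ?_) ?_ ?_ ?_ ?_ ?_ ?_ ?_ ?_ ?_⟩)
    · have := hli (k * (2 / r)) (l * (4 / r ^ 2) + m * (q / r)) m (by rw [← h]; module)
      obtain ⟨h1, h2, rfl⟩ := this
      simp [hr] at h1 h2
      exact ⟨h1, h2, rfl⟩
    all_goals
      simp only [mul_eq_symMul_add_commMul, map_smul, map_add, LinearMap.smul_apply,
        LinearMap.add_apply, s00, s01, s02, s10, s11, s12, s20, s21, s22, h01, h02, h10, h12, h20,
        h21, commMul_self]
      simp [table, e₁, e₂, e₃]
    all_goals match_scalars <;> field_simp <;> norm_num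

/-- Applying the Leibniz rule to e₁∘e₁ = 0 and e₂∘e₂ = 0 leaves [e₁, e₂] = re₃ with e₃ central.
Halving the commutator makes the parameter r/2. -/
theorem isClassified_of_A02 (hfr : Module.finrank ℂ K = 3)
    (hb : ∀ i j, symMul K (b i) (b j) = (2 : ℂ) • ∑ k, table (.A02 0) i j k • b k) :
    IsClassified K := by
  have hli := coords_eq_zero b
  obtain ⟨p, q, r, h01⟩ := exists_coords b (commMul K (b 0) (b 1))
  have s00 : symMul K (b 0) (b 0) = 0 := by simp [hb, table, e₃, Fin.sum_univ_three]
  have s01 : symMul K (b 0) (b 1) = (2 : ℂ) • b 2 := by simp [hb, table, e₃, Fin.sum_univ_three]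
  have s02 : symMul K (b 0) (b 2) = 0 := by simp [hb, table, e₃, Fin.sum_univ_three]
  have s10 : symMul K (b 1) (b 0) = (2 : ℂ) • b 2 := by simp [hb, table, e₃, Fin.sum_univ_three]
  have s11 : symMul K (b 1) (b 1) = 0 := by simp [hb, table, e₃, Fin.sum_univ_three]
  have s12 : symMul K (b 1) (b 2) = 0 := by simp [hb, table, e₃, Fin.sum_univ_three]
  have s20 : symMul K (b 2) (b 0) = 0 := by simp [hb, table, e₃, Fin.sum_univ_three]
  have s21 : symMul K (b 2) (b 1) = 0 := by simp [hb, table, e₃, Fin.sum_univ_three]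
  have s22 : symMul K (b 2) (b 2) = 0 := by simp [hb, table, e₃, Fin.sum_univ_three]
  have h10 := commMul_swap (b 1) (b 0)
  rw [h01] at h10
  have hq : q = 0 := by
    have h1 := commMul_symMul hK (b 0) (b 0) (b 1)
    rw [s00, h01] at h1
    simp only [map_zero, map_neg, LinearMap.zero_apply, map_add, map_smul, s00, s01, s02] at h1
    have := (hli 0 0 (4 * q) (by linear_combination (norm := module) -(1 : ℂ) • h1)).2.2
    simpa using this
  subst hq
  have hp : p = 0 := by
    have h1 := commMul_symMul hK (b 1) (b 1) (b 0)
    rw [s11, h10] at h1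
    simp only [map_zero, map_neg, LinearMap.zero_apply, map_add, map_smul, s10, s11, s12] at h1
    have := (hli 0 0 (4 * p) (by linear_combination (norm := module) h1)).2.2
    simpa using this
  subst hp
  have h20 : commMul K (b 2) (b 0) = 0 := by
    have h1 := commMul_symMul hK (b 0) (b 1) (b 0)
    rw [s01, h10, commMul_self] at h1
    simpa [s00, s01, s02] using h1
  have h21 : commMul K (b 2) (b 1) = 0 := by
    have h1 := commMul_symMul hK (b 0) (b 1) (b 1)
    rw [s01, h01, commMul_self] at h1
    simpa [s10, s11, s12] using h1
  have h02 : commMul K (b 0) (b 2) = 0 := by rw [commMul_swap, h20, neg_zero]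
  have h12 : commMul K (b 1) (b 2) = 0 := by rw [commMul_swap, h21, neg_zero]
  by_cases hr : r = 0
  · subst hr
    exact isClassified_of_commMul_eq_zero hK (N := .A02 0) (by simp [commutativeList]) hb
      (by rw [h01]; module) h02 h12
  · refine Or.inr (Or.inr ⟨.A02 (r / 2), by simp [properList, hr], algIso_of_triple hfr _
        (x := b 0) (y := b 1) (z := b 2) hli ?_ ?_ ?_ ?_ ?_ ?_ ?_ ?_ ?_⟩)
    all_goals
      simp only [mul_eq_symMul_add_commMul, s00, s01, s02, s10, s11, s12, s20, s21, s22, h01, h02,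
        h10, h12, h20, h21, commMul_self]
      simp [table, e₁, e₂, e₃]
    all_goals (match_scalars; ring)

/-- A⁺ is generated by e₁, so the Leibniz rule propagates [e₁, e₁] = 0 to every commutator. -/
theorem isClassified_of_A03
    (hb : ∀ i j, symMul K (b i) (b j) = (2 : ℂ) • ∑ k, table .A03 i j k • b k) :
    IsClassified K := by
  have s00 : symMul K (b 0) (b 0) = (2 : ℂ) • b 1 := by simp [hb, table, e₂, Fin.sum_univ_three]
  have s01 : symMul K (b 0) (b 1) = (2 : ℂ) • b 2 := by simp [hb, table, e₃, Fin.sum_univ_three]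
  have h10 : commMul K (b 1) (b 0) = 0 := by
    have h1 := commMul_symMul hK (b 0) (b 0) (b 0)
    rw [s00, commMul_self] at h1
    simpa using h1
  have h01 : commMul K (b 0) (b 1) = 0 := by rw [commMul_swap, h10, neg_zero]
  have h20 : commMul K (b 2) (b 0) = 0 := by
    have h1 := commMul_symMul hK (b 0) (b 1) (b 0)
    rw [s01, h10, commMul_self] at h1
    simpa using h1
  have h21 : commMul K (b 2) (b 1) = 0 := by
    have h1 := commMul_symMul hK (b 0) (b 1) (b 1)
    rw [s01, h01, commMul_self] at h1
    simpa using h1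
  exact isClassified_of_commMul_eq_zero hK (N := .A03) (by simp [commutativeList]) hb h01
    (by rw [commMul_swap, h20, neg_zero]) (by rw [commMul_swap, h21, neg_zero])

/-- An idempotent basis vector acting diagonally with integer eigenvalues is central. -/
theorem commMul_eq_zero_of_idempotent {i : Fin 3} (hi : symMul K (b i) (b i) = (2 : ℂ) • b i)
    {p q r : ℂ} (hp : p = 0 ∨ p = 2) (hq : q = 0 ∨ q = 2) (hr : r = 0 ∨ r = 2)
    (h0 : symMul K (b i) (b 0) = p • b 0) (h1 : symMul K (b i) (b 1) = q • b 1)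
    (h2 : symMul K (b i) (b 2) = r • b 2) (w : K) : commMul K (b i) w = 0 := by
  obtain ⟨k, l, m, h⟩ := exists_coords b (commMul K (b i) w)
  have h3 := symMul_commMul_of_idempotent hK hi w
  rw [h] at h3
  simp only [map_add, map_smul, h0, h1, h2] at h3
  obtain ⟨h4, h5, h6⟩ := coords_eq_zero b (k * (p - 1)) (l * (q - 1)) (m * (r - 1))
    (by linear_combination (norm := module) h3)
  have hne : ∀ t : ℂ, t = 0 ∨ t = 2 → t - 1 ≠ 0 := by
    rintro t (rfl | rfl) <;> norm_num
  rw [h, (mul_eq_zero.1 h4).resolve_right (hne p hp), (mul_eq_zero.1 h5).resolve_right (hne q hq),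
    (mul_eq_zero.1 h6).resolve_right (hne r hr)]
  simp

/-- Two of the three basis vectors are idempotents and commute with everything, so no basis
commutator is left. -/
theorem isClassified_of_two_idempotents {N : Name} (hN : N = .A04 ∨ N = .A05 ∨ N = .A08)
    (hb : ∀ i j, symMul K (b i) (b j) = (2 : ℂ) • ∑ k, table N i j k • b k) :
    IsClassified K := by
  have h0 : ∀ w, commMul K (b 0) w = 0 := by
    refine commMul_eq_zero_of_idempotent hK ?_ (p := 2) (q := 0) (r := 0) (by simp) (by simp)
      (by simp) ?_ ?_ ?_ <;> rcases hN with rfl | rfl | rfl <;>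
      simp [hb, table, e₁, e₂, e₃, Fin.sum_univ_three]
  have h1 : ∀ w, commMul K (b 1) w = 0 := by
    rcases hN with rfl | rfl | rfl
    · refine commMul_eq_zero_of_idempotent hK ?_ (p := 0) (q := 2) (r := 0) (by simp) (by simp)
        (by simp) ?_ ?_ ?_ <;> simp [hb, table, e₁, e₂, e₃, Fin.sum_univ_three]
    · refine commMul_eq_zero_of_idempotent hK ?_ (p := 0) (q := 2) (r := 2) (by simp) (by simp)
        (by simp) ?_ ?_ ?_ <;> simp [hb, table, e₁, e₂, e₃, Fin.sum_univ_three]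
    · refine commMul_eq_zero_of_idempotent hK ?_ (p := 0) (q := 2) (r := 0) (by simp) (by simp)
        (by simp) ?_ ?_ ?_ <;> simp [hb, table, e₁, e₂, e₃, Fin.sum_univ_three]
  exact isClassified_of_commMul_eq_zero hK (N := N)
    (by rcases hN with rfl | rfl | rfl <;> simp [commutativeList]) hb (h0 _) (h0 _) (h1 _)

/-- The idempotent e₁ is central, and e₃ = e₂∘e₂ commutes with e₂. -/
theorem isClassified_of_A07_or_A11 {N : Name} (hN : N = .A07 ∨ N = .A11)
    (hb : ∀ i j, symMul K (b i) (b j) = (2 : ℂ) • ∑ k, table N i j k • b k) :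
    IsClassified K := by
  have h0 : ∀ w, commMul K (b 0) w = 0 := by
    rcases hN with rfl | rfl
    · refine commMul_eq_zero_of_idempotent hK ?_ (p := 2) (q := 2) (r := 2) (by simp) (by simp)
        (by simp) ?_ ?_ ?_ <;> simp [hb, table, e₁, e₂, e₃, Fin.sum_univ_three]
    · refine commMul_eq_zero_of_idempotent hK ?_ (p := 2) (q := 0) (r := 0) (by simp) (by simp)
        (by simp) ?_ ?_ ?_ <;> simp [hb, table, e₁, e₂, e₃, Fin.sum_univ_three]
  have s11 : symMul K (b 1) (b 1) = (2 : ℂ) • b 2 := by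
    rcases hN with rfl | rfl <;> simp [hb, table, e₁, e₂, e₃, Fin.sum_univ_three]
  have h21 : commMul K (b 2) (b 1) = 0 := by
    have h1 := commMul_symMul hK (b 1) (b 1) (b 1)
    rw [s11, commMul_self] at h1
    simpa using h1
  exact isClassified_of_commMul_eq_zero hK (N := N)
    (by rcases hN with rfl | rfl <;> simp [commutativeList]) hb (h0 _) (h0 _)
    (by rw [commMul_swap, h21, neg_zero])

/-- With e₁ central, e₁∘ passes through commutators. Hence [e₂, e₃] is fixed by e₁∘ through e₂ and
killed by it through e₃. -/
theorem isClassified_of_A09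
    (hb : ∀ i j, symMul K (b i) (b j) = (2 : ℂ) • ∑ k, table .A09 i j k • b k) :
    IsClassified K := by
  have s00 : symMul K (b 0) (b 0) = (2 : ℂ) • b 0 := by simp [hb, table, e₁, Fin.sum_univ_three]
  have s01 : symMul K (b 0) (b 1) = (2 : ℂ) • b 1 := by simp [hb, table, e₂, Fin.sum_univ_three]
  have s02 : symMul K (b 0) (b 2) = 0 := by simp [hb, table, Fin.sum_univ_three]
  have h0 : ∀ w, commMul K (b 0) w = 0 :=
    commMul_eq_zero_of_idempotent hK s00 (p := 2) (q := 2) (r := 0) (by simp) (by simp) (by simp)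
      s00 s01 (by rw [s02, zero_smul])
  have h1 : symMul K (b 0) (commMul K (b 2) (b 1)) = 0 := by
    have h2 := commMul_symMul hK (b 0) (b 2) (b 1)
    rw [s02, h0] at h2
    simpa using h2.symm
  have h2 : commMul K (b 1) (b 2) = 0 := by
    have h3 := commMul_symMul hK (b 0) (b 1) (b 2)
    rw [s01, h0, commMul_swap (b 1) (b 2), map_neg, h1, map_smul, LinearMap.smul_apply,
      commMul_swap (b 1) (b 2)] at h3
    rw [commMul_swap]
    simpa using h3
  exact isClassified_of_commMul_eq_zero hK (N := .A09) (by simp [commutativeList]) hb (h0 _) (h0 _)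
    h2

/-- The idempotent is central, and [e₂, e₃] stays in the span of e₂ and e₃. On that plane the
commutator is zero or the two-dimensional nonabelian Lie bracket. Whether e₁ acts there as the unit
or as zero decides between the two pairs of tables. -/
theorem isClassified_of_A06_or_A10 (hfr : Module.finrank ℂ K = 3) {N N' : Name}
    (hN : N = .A06 ∧ N' = .A29 ∨ N = .A10 ∧ N' = .A30)
    (hb : ∀ i j, symMul K (b i) (b j) = (2 : ℂ) • ∑ k, table N i j k • b k) :
    IsClassified K := by
  have hli := coords_eq_zero b
  obtain ⟨p, q, r, h12⟩ := exists_coords b (commMul K (b 1) (b 2))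
  -- The number t is the eigenvalue of x ↦ e₁x + xe₁ on e₂ and e₃: 2 for `A06`, 0 for `A10`.
  obtain ⟨t, ht, htN, s00, s01, s02, s10, s20⟩ : ∃ t : ℂ, (t = 0 ∨ t = 2) ∧
      (table N' 0 1 = (t / 2) • e₂ ∧ table N' 1 0 = (t / 2) • e₂ ∧
        table N' 0 2 = (t / 2) • e₃ ∧ table N' 2 0 = (t / 2) • e₃) ∧
      symMul K (b 0) (b 0) = (2 : ℂ) • b 0 ∧
      symMul K (b 0) (b 1) = t • b 1 ∧ symMul K (b 0) (b 2) = t • b 2 ∧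
      symMul K (b 1) (b 0) = t • b 1 ∧ symMul K (b 2) (b 0) = t • b 2 := by
    rcases hN with ⟨rfl, rfl⟩ | ⟨rfl, rfl⟩
    · exact ⟨2, by simp, by simp [table],
        by simp [hb, table, e₁, Fin.sum_univ_three], by simp [hb, table, e₂, Fin.sum_univ_three],
        by simp [hb, table, e₃, Fin.sum_univ_three], by simp [hb, table, e₂, Fin.sum_univ_three],
        by simp [hb, table, e₃, Fin.sum_univ_three]⟩
    · exact ⟨0, by simp, by simp [table],
        by simp [hb, table, e₁, Fin.sum_univ_three], by simp [hb, table, e₂, Fin.sum_univ_three],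
        by simp [hb, table, e₃, Fin.sum_univ_three], by simp [hb, table, e₂, Fin.sum_univ_three],
        by simp [hb, table, e₃, Fin.sum_univ_three]⟩
  have s11 : symMul K (b 1) (b 1) = 0 := by
    rcases hN with ⟨rfl, rfl⟩ | ⟨rfl, rfl⟩ <;> simp [hb, table, Fin.sum_univ_three]
  have s12 : symMul K (b 1) (b 2) = 0 := by
    rcases hN with ⟨rfl, rfl⟩ | ⟨rfl, rfl⟩ <;> simp [hb, table, Fin.sum_univ_three]
  have s21 : symMul K (b 2) (b 1) = 0 := by rw [symMul_comm, s12]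
  have s22 : symMul K (b 2) (b 2) = 0 := by
    rcases hN with ⟨rfl, rfl⟩ | ⟨rfl, rfl⟩ <;> simp [hb, table, Fin.sum_univ_three]
  have h0 : ∀ w, commMul K (b 0) w = 0 :=
    commMul_eq_zero_of_idempotent hK s00 (p := 2) (q := t) (r := t) (by simp) ht ht s00 s01 s02
  have h0' : ∀ w, commMul K w (b 0) = 0 := fun w => by rw [commMul_swap, h0, neg_zero]
  have hp : p = 0 := by
    rcases ht with rfl | rfl
    · have h1 := commMul_symMul hK (b 0) (b 1) (b 2)
      rw [s01, h12, h0] at h1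
      simp only [map_zero, zero_smul, LinearMap.zero_apply, map_add, map_smul, s00, s01, s02] at h1
      have := (hli (2 * p) 0 0 (by linear_combination (norm := module) -(1 : ℂ) • h1)).1
      simpa using this
    · have h1 := commMul_symMul hK (b 1) (b 1) (b 2)
      rw [s11, h12] at h1
      simp only [map_zero, LinearMap.zero_apply, map_add, map_smul, s10, s11, s12] at h1
      have := (hli 0 (4 * p) 0 (by linear_combination (norm := module) -(1 : ℂ) • h1)).2.1
      simpa using this
  subst hp
  have h21 := commMul_swap (b 2) (b 1)
  rw [h12] at h21
  have hN' : N' ∈ properList := by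
    rcases hN with ⟨-, rfl⟩ | ⟨-, rfl⟩ <;> simp [properList]
  have t00 : table N' 0 0 = e₁ := by
    rcases hN with ⟨-, rfl⟩ | ⟨-, rfl⟩ <;> simp [table]
  have t11 : table N' 1 1 = 0 := by
    rcases hN with ⟨-, rfl⟩ | ⟨-, rfl⟩ <;> simp [table]
  have t12 : table N' 1 2 = e₃ := by
    rcases hN with ⟨-, rfl⟩ | ⟨-, rfl⟩ <;> simp [table]
  have t21 : table N' 2 1 = -e₃ := by
    rcases hN with ⟨-, rfl⟩ | ⟨-, rfl⟩ <;> simp [table]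
  have t22 : table N' 2 2 = 0 := by
    rcases hN with ⟨-, rfl⟩ | ⟨-, rfl⟩ <;> simp [table]
  by_cases hr : r = 0
  · subst hr
    by_cases hq : q = 0
    · subst hq
      refine isClassified_of_commMul_eq_zero hK (N := N) ?_ hb (h0 _) (h0 _) (by rw [h12]; module)
      rcases hN with ⟨rfl, -⟩ | ⟨rfl, -⟩ <;> simp [commutativeList]
    · refine Or.inr (Or.inr ⟨N', hN', algIso_of_triple hfr _
        (x := b 0) (y := (-2 / q) • b 2) (z := b 1) (fun k l m h => ?_) ?_ ?_ ?_ ?_ ?_ ?_ ?_ ?_ ?_⟩)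
      · have := hli k m (l * (-2 / q)) (by rw [← h]; module)
        simp [hq] at this
        tauto
      all_goals
        simp only [mul_eq_symMul_add_commMul, map_smul, map_add, LinearMap.smul_apply,
          LinearMap.add_apply, s00, s01, s02, s10, s11, s12, s20, s21, s22, h0, h0', h12, h21,
          commMul_self, htN, t00, t11, t12, t21, t22]
        simp [e₁, e₂, e₃]
      all_goals (match_scalars; field_simp)
  -- The third vector is [e₂, e₃] itself, and the second is e₂ scaled so that their commutator is
  -- 2z.
  · refine Or.inr (Or.inr ⟨N', hN', algIso_of_triple hfr _
        (x := b 0) (y := (2 / r) • b 1) (z := q • b 1 + r • b 2) (fun k l m h => ?_)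
        ?_ ?_ ?_ ?_ ?_ ?_ ?_ ?_ ?_⟩)
    · obtain ⟨h1, h2, h3⟩ := hli k (l * (2 / r) + m * q) (m * r) (by rw [← h]; module)
      have hm : m = 0 := by simpa [hr] using h3
      subst hm
      simp [hr] at h2
      exact ⟨h1, h2, rfl⟩
    all_goals
      simp only [mul_eq_symMul_add_commMul, map_smul, map_add, LinearMap.smul_apply,
        LinearMap.add_apply, s00, s01, s02, s10, s11, s12, s20, s21, s22, h0, h0', h12, h21,
        commMul_self, htN, t00, t11, t12, t21, t22]
      simp [e₁, e₂, e₃]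
    all_goals match_scalars <;> field_simp <;> norm_num

/-- Classification of Kokoris algebras of dimension three. -/
theorem isClassified (hfr : Module.finrank ℂ K = 3) : IsClassified K := by
  let := Plus.nonUnitalCommRing hK
  have := Plus.isScalarTower hK
  have := Plus.smulCommClass hK
  have hP : Module.finrank ℂ (Plus K) = 3 := by rw [← (Plus.of K).finrank_eq, hfr]
  obtain ⟨N, hN, hiso⟩ := exists_commutativeList hP
  obtain ⟨b, hb⟩ := exists_basis_of_plus hK hiso
  simp only [commutativeList, Set.mem_insert_iff, Set.mem_singleton_iff] at hN
  rcases hN with rfl | rfl | rfl | rfl | rfl | rfl | rfl | rfl | rfl | rfl | rfl | rfl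
  · exact isClassified_of_A00 hfr hb
  · exact isClassified_of_A01 hK hfr hb
  · exact isClassified_of_A02 hK hfr hb
  · exact isClassified_of_A03 hK hb
  · exact isClassified_of_two_idempotents hK (by simp) hb
  · exact isClassified_of_two_idempotents hK (by simp) hb
  · exact isClassified_of_A06_or_A10 hK hfr (Or.inl ⟨rfl, rfl⟩) hb
  · exact isClassified_of_A07_or_A11 hK (by simp) hb
  · exact isClassified_of_two_idempotents hK (by simp) hb
  · exact isClassified_of_A09 hK hb
  · exact isClassified_of_A06_or_A10 hK hfr (Or.inr ⟨rfl, rfl⟩) hb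
  · exact isClassified_of_A07_or_A11 hK (by simp) hb

end Classification

end Kokoris

/-! ### Isomorphisms between anticommutative algebras of the list -/

namespace Kokoris

theorem algIso_A02_neg (α : ℂ) : AlgIso (Alg (.A02 α)) (Alg (.A02 (-α))) := by
  let e : Alg (.A02 α) ≃ₗ[ℂ] Alg (.A02 (-α)) :=
    LinearEquiv.funCongrLeft ℂ ℂ (Equiv.swap (0 : Fin 3) 1)
  have he : ∀ x k, (e x).coord k = x.coord (Equiv.swap 0 1 k) := fun _ _ => rfl
  refine algIso_of_linearEquiv (TableAlgebra.basis _) e fun i j => TableAlgebra.ext_coord fun k => ?_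
  rw [he, alg_mul_coord, alg_mul_coord]
  simp only [mulVec, he]
  have h2 : Equiv.swap (0 : Fin 3) 1 2 = 2 := rfl
  fin_cases k <;> simp [h2]
  ring

theorem algIso_A22_inv {α : ℂ} (hα : α ≠ 0) : AlgIso (Alg (.A22 α)) (Alg (.A22 α⁻¹)) := by
  by_cases h1 : α = 1
  · subst h1; rw [inv_one]; exact AlgIso.refl _
  rw [algIso_iff_projCongr (by simp [anticommutativeList]) (by simp [anticommutativeList])]
  have h2 : α - 1 ≠ 0 := sub_ne_zero.2 h1
  -- The first row spans the other isotropic line of the form on the plane; exchanging the two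
  -- isotropic lines inverts the parameter.
  refine projCongr_of_gram _ _ ![1 / (α - 1), 1, 0] ![1 + α / (α - 1) ^ 2, α / (α - 1), 0] ![0, 0, 1]
    (neg_ne_zero.2 hα) ?_ ?_
  · simp
    have : (α - 1)⁻¹ * (α / (α - 1)) - (1 + α / (α - 1) ^ 2) = -1 := by field_simp; ring
    rw [this]; norm_num
  intro i j
  fin_cases i <;> fin_cases j <;> simp [Fin.sum_univ_three, antiForm] <;> field_simp <;> ring

theorem algIso_A24_inv {α : ℂ} (hα : α ≠ 0) : AlgIso (Alg (.A24 α)) (Alg (.A24 α⁻¹)) := by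
  by_cases h1 : α = 1
  · subst h1; rw [inv_one]; exact AlgIso.refl _
  by_cases h2 : α = -1
  · subst h2; rw [show (-1 : ℂ)⁻¹ = -1 by norm_num]; exact AlgIso.refl _
  rw [algIso_iff_projCongr (by simp [anticommutativeList]) (by simp [anticommutativeList])]
  have h3 : α - 1 ≠ 0 := sub_ne_zero.2 h1
  have h4 : 1 + α ≠ 0 := fun h => h2 (by linear_combination h)
  -- The first row spans the kernel of the skew part, with value (1 + α)². It splits off, and
  -- listing the isotropic pair of the complement in the opposite order makes `projCongr_A24` return
  -- α⁻¹.
  have h5 : ProjCongr (antiForm (.A24 α))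
      !![(1 + α) ^ 2, 0, 0; 0, 0, α * (1 + α); 0, -(1 + α), 0] := by
    refine projCongr_of_gram _ _ ![1, 0, -(1 + α)] ![α / ((1 + α) * (α - 1)), 1 + α, α] ![1, 0, 0]
      one_ne_zero ?_ ?_
    · have : -1 - α ≠ 0 := fun h => h4 (by linear_combination -h)
      simpa [sub_eq_add_neg, add_comm] using this
    intro i j
    fin_cases i <;> fin_cases j <;> simp [Fin.sum_univ_three, antiForm] <;> field_simp <;> ring
  have h6 := projCongr_A24 (a := (1 + α) ^ 2) (p := α * (1 + α)) (q := -(1 + α))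
    (pow_ne_zero _ h4) (mul_ne_zero hα h4)
    (fun h => mul_ne_zero h4 h4 (by linear_combination h))
    (fun h => mul_ne_zero h3 h4 (by linear_combination h))
  rw [show - -(1 + α) / (α * (1 + α)) = α⁻¹ by field_simp] at h6
  exact h5.trans h6

open Matrix in
-- Transposition commutes with congruence, so the same G and c serve every t. The set of t at which
-- M − tMᵀ drops to a given rank is then an isomorphism invariant.
theorem projCongr_pencil {M M' : Matrix (Fin 3) (Fin 3) ℂ} (h : ProjCongr M M') (t : ℂ) :
    ProjCongr (M - t • Mᵀ) (M' - t • M'ᵀ) := by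
  obtain ⟨G, c, hG, hc, h⟩ := h
  refine ⟨G, c, hG, hc, ?_⟩
  have h' : G * Mᵀ * Gᵀ = c • M'ᵀ := by
    have := congrArg Matrix.transpose h
    rwa [Matrix.transpose_mul, Matrix.transpose_mul, Matrix.transpose_transpose,
        Matrix.transpose_smul, ← Matrix.mul_assoc] at this
  rw [Matrix.mul_sub, Matrix.sub_mul, h, Matrix.mul_smul, Matrix.smul_mul, h', smul_sub,
    smul_comm]

theorem _root_.ProjCongr.eq_zero_of {M M' : Matrix (Fin 3) (Fin 3) ℂ} (h : ProjCongr M M')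
    (hM : M = 0) : M' = 0 := by
  obtain ⟨G, c, hG, hc, h⟩ := h
  rw [hM, Matrix.mul_zero, Matrix.zero_mul] at h
  exact (smul_eq_zero.1 h.symm).resolve_left hc

theorem _root_.ProjCongr.det_eq_zero_of {M M' : Matrix (Fin 3) (Fin 3) ℂ} (h : ProjCongr M M')
    (hM : M.det = 0) : M'.det = 0 := by
  obtain ⟨G, c, hG, hc, h⟩ := h
  have h1 := congrArg Matrix.det h
  rw [Matrix.det_mul, Matrix.det_mul, hM, mul_zero, zero_mul, Matrix.det_smul] at h1
  exact (mul_eq_zero.1 h1.symm).resolve_left (pow_ne_zero _ hc)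

theorem _root_.ProjCongr.adjugate_eq_zero_of {M M' : Matrix (Fin 3) (Fin 3) ℂ}
    (h : ProjCongr M M') (hM : M.adjugate = 0) : M'.adjugate = 0 := by
  obtain ⟨G, c, hG, hc, h⟩ := h
  have h1 := congrArg Matrix.adjugate h
  rw [Matrix.adjugate_mul_distrib, Matrix.adjugate_mul_distrib, hM, Matrix.zero_mul,
    Matrix.mul_zero, Matrix.adjugate_smul] at h1
  exact (smul_eq_zero.1 h1.symm).resolve_left (pow_ne_zero _ hc)

/-- The pencil `M - t Mᵀ` of the matrix of an anticommutative algebra. -/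
noncomputable def pencil (N : Name) (t : ℂ) : Matrix (Fin 3) (Fin 3) ℂ :=
  antiForm N - t • (antiForm N).transpose

theorem pencil_A00 (t : ℂ) : pencil .A00 t = !![0, 0, 0; 0, 0, 0; 0, 0, 0] := by
  ext i j; fin_cases i <;> fin_cases j <;> simp [pencil, antiForm]

theorem pencil_A20 (t : ℂ) : pencil .A20 t = !![1 - t, 0, 0; 0, 0, 0; 0, 0, 0] := by
  ext i j; fin_cases i <;> fin_cases j <;> simp [pencil, antiForm]

theorem pencil_A21 (t : ℂ) : pencil .A21 t = !![0, -1 - t, 0; 1 + t, 0, 0; 0, 0, 0] := by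
  ext i j; fin_cases i <;> fin_cases j <;> simp [pencil, antiForm]

theorem pencil_A22 (α t : ℂ) :
    pencil (.A22 α) t = !![0, -1 - t * α, 0; α + t, -1 + t, 0; 0, 0, 0] := by
  ext i j; fin_cases i <;> fin_cases j <;> simp [pencil, antiForm]

theorem pencil_A23 (t : ℂ) : pencil .A23 t = !![1 - t, 0, 0; 0, 1 - t, 0; 0, 0, 1 - t] := by
  ext i j; fin_cases i <;> fin_cases j <;> simp [pencil, antiForm]

theorem pencil_A24 (α t : ℂ) :
    pencil (.A24 α) t = !![0, -1 - t * α, 0; α + t, 0, t; 0, -1, 1 - t] := by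
  ext i j; fin_cases i <;> fin_cases j <;> simp [pencil, antiForm]

theorem pencil_A25 (t : ℂ) : pencil .A25 t = !![0, -t, 1; 1, 0, 0; -t, 0, 0] := by
  ext i j; fin_cases i <;> fin_cases j <;> simp [pencil, antiForm]

theorem pencil_A26 (t : ℂ) : pencil .A26 t = !![0, -1 - t, 0; 1 + t, 0, 0; 0, 0, 1 - t] := by
  ext i j; fin_cases i <;> fin_cases j <;> simp [pencil, antiForm]

/-- The entries of a 3 × 3 matrix vanish. -/
theorem matrix_eq_zero_iff (M : Matrix (Fin 3) (Fin 3) ℂ) :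
    M = 0 ↔ (M 0 0 = 0 ∧ M 0 1 = 0 ∧ M 0 2 = 0) ∧ (M 1 0 = 0 ∧ M 1 1 = 0 ∧ M 1 2 = 0) ∧
      (M 2 0 = 0 ∧ M 2 1 = 0 ∧ M 2 2 = 0) := by
  rw [← Matrix.ext_iff]
  simp [Fin.forall_fin_succ]

theorem pencil_A00_facts (t : ℂ) : pencil .A00 t = 0 ∧ (pencil .A00 t).adjugate = 0 ∧
    (pencil .A00 t).det = 0 := by
  simp [matrix_eq_zero_iff, Matrix.adjugate_fin_three, Matrix.det_fin_three, pencil_A00]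

theorem pencil_A20_facts (t : ℂ) : (pencil .A20 t = 0 ↔ t = 1) ∧ (pencil .A20 t).adjugate = 0 ∧
    (pencil .A20 t).det = 0 := by
  have h1 : 1 - t = 0 ↔ t = 1 := by rw [sub_eq_zero, eq_comm]
  simp [matrix_eq_zero_iff, Matrix.adjugate_fin_three, Matrix.det_fin_three, pencil_A20, h1]

theorem pencil_A21_facts (t : ℂ) : (pencil .A21 t = 0 ↔ t = -1) ∧
    ((pencil .A21 t).adjugate = 0 ↔ t = -1) ∧ (pencil .A21 t).det = 0 := by
  have h1 : -1 - t = 0 ↔ t = -1 := by rw [sub_eq_zero, eq_comm]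
  have h2 : 1 + t = 0 ↔ t = -1 := by rw [add_comm, add_eq_zero_iff_eq_neg]
  simp [matrix_eq_zero_iff, Matrix.adjugate_fin_three, Matrix.det_fin_three, pencil_A21, h1, h2]

theorem pencil_A22_facts (α t : ℂ) : (pencil (.A22 α) t = 0 ↔ α = -1 ∧ t = 1) ∧
    ((pencil (.A22 α) t).adjugate = 0 ↔ (1 + t * α) * (α + t) = 0) ∧
    (pencil (.A22 α) t).det = 0 := by
  have h1 : -1 - t * α = 0 ↔ 1 + t * α = 0 := by
    constructor <;> intro h <;> linear_combination -h
  have h2 : -1 + t = 0 ↔ t = 1 := by rw [neg_add_eq_zero, eq_comm]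
  refine ⟨?_, ?_, ?_⟩
  · simp only [matrix_eq_zero_iff, pencil_A22]
    simp [h1, h2]
    constructor
    · rintro ⟨-, h, rfl⟩
      exact ⟨by linear_combination h, rfl⟩
    · rintro ⟨rfl, rfl⟩
      norm_num
  · simp [matrix_eq_zero_iff, Matrix.adjugate_fin_three, pencil_A22, h1]
  · simp [Matrix.det_fin_three, pencil_A22]

theorem pencil_A23_facts (t : ℂ) : (pencil .A23 t = 0 ↔ t = 1) ∧
    ((pencil .A23 t).adjugate = 0 ↔ t = 1) ∧ ((pencil .A23 t).det = 0 ↔ t = 1) := by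
  have h1 : 1 - t = 0 ↔ t = 1 := by rw [sub_eq_zero, eq_comm]
  simp [matrix_eq_zero_iff, Matrix.adjugate_fin_three, Matrix.det_fin_three, pencil_A23, h1]

theorem pencil_A24_facts (α t : ℂ) : pencil (.A24 α) t ≠ 0 ∧
    (pencil (.A24 α) t).adjugate ≠ 0 ∧
    ((pencil (.A24 α) t).det = 0 ↔ (1 + t * α) * (α + t) * (1 - t) = 0) := by
  refine ⟨?_, ?_, ?_⟩
  · simp [matrix_eq_zero_iff, pencil_A24]
  · simp [matrix_eq_zero_iff, Matrix.adjugate_fin_three, pencil_A24]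
    rintro rfl
    norm_num
  · have : (pencil (.A24 α) t).det = (1 + t * α) * (α + t) * (1 - t) := by
      simp [Matrix.det_fin_three, pencil_A24]
      ring
    rw [this]

theorem pencil_A25_facts (t : ℂ) : pencil .A25 t ≠ 0 ∧
    (pencil .A25 t).adjugate ≠ 0 ∧ (pencil .A25 t).det = 0 := by
  refine ⟨?_, ?_, ?_⟩
  · simp [matrix_eq_zero_iff, pencil_A25]
  · simp [matrix_eq_zero_iff, Matrix.adjugate_fin_three, pencil_A25]
  · simp [Matrix.det_fin_three, pencil_A25]

theorem pencil_A26_facts (t : ℂ) : pencil .A26 t ≠ 0 ∧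
    ((pencil .A26 t).adjugate = 0 ↔ t = -1) ∧ ((pencil .A26 t).det = 0 ↔ t = -1 ∨ t = 1) := by
  have h1 : -1 - t = 0 ↔ t = -1 := by rw [sub_eq_zero, eq_comm]
  have h2 : 1 + t = 0 ↔ t = -1 := by rw [add_comm, add_eq_zero_iff_eq_neg]
  have h3 : 1 - t = 0 ↔ t = 1 := by rw [sub_eq_zero, eq_comm]
  refine ⟨?_, ?_, ?_⟩
  · simp only [ne_eq, matrix_eq_zero_iff, pencil_A26]
    simp [h1, h3]
    rintro rfl
    norm_num
  · simp [matrix_eq_zero_iff, Matrix.adjugate_fin_three, pencil_A26, h1, h2, h3]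
    tauto
  · simp [Matrix.det_fin_three, pencil_A26, h1, h2, h3]

/-- Vanishing of the matrix, of the adjugate and of the determinant detect rank 0, at most 1 and at
most 2 in the pencil. The parameter is read off from the roots −α, −1/α of the adjugate condition
for `A22`, and of the determinant for `A24`. -/
theorem anticommutative_algIso {M N : Name} (hM : M ∈ anticommutativeList)
    (hN : N ∈ anticommutativeList) (h : AlgIso (Alg M) (Alg N)) :
    M = N ∨ (∃ α : ℂ, α ≠ 0 ∧ M = .A22 α ∧ N = .A22 α⁻¹) ∨
      (∃ α : ℂ, α ≠ 0 ∧ M = .A24 α ∧ N = .A24 α⁻¹) := by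
  have h1 : ∀ t, ProjCongr (pencil M t) (pencil N t) := fun t =>
    projCongr_pencil ((algIso_iff_projCongr hM hN).1 h) t
  have h2 : ∀ t, ProjCongr (pencil N t) (pencil M t) := fun t =>
    projCongr_pencil ((algIso_iff_projCongr hN hM).1 h.symm) t
  have hZ : ∀ t, pencil M t = 0 ↔ pencil N t = 0 := fun t =>
    ⟨(h1 t).eq_zero_of, (h2 t).eq_zero_of⟩
  have hA : ∀ t, (pencil M t).adjugate = 0 ↔ (pencil N t).adjugate = 0 := fun t =>
    ⟨(h1 t).adjugate_eq_zero_of, (h2 t).adjugate_eq_zero_of⟩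
  have hD : ∀ t, (pencil M t).det = 0 ↔ (pencil N t).det = 0 := fun t =>
    ⟨(h1 t).det_eq_zero_of, (h2 t).det_eq_zero_of⟩
  clear h h1 h2
  have hpair : ∀ α β : ℂ, (1 - α * β) * (β - α) = 0 → α = β ∨ (α ≠ 0 ∧ β = α⁻¹) := by
    intro α β h
    rcases mul_eq_zero.1 h with h | h
    · have hα : α ≠ 0 := by rintro rfl; simp at h
      exact Or.inr ⟨hα, eq_inv_of_mul_eq_one_right (by linear_combination -h)⟩
    · exact Or.inl (by linear_combination -h)
  simp only [anticommutativeList, Set.mem_union, Set.mem_insert_iff, Set.mem_singleton_iff,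
    Set.mem_range] at hM hN
  -- Finitely many sample values of t settle every pair except `A22` against `A25` and the pairs
  -- within `A22` or within `A24`, where t must depend on the parameter.
  have z1 := hZ 1
  have z2 := hZ (-1)
  have z3 := hZ 2
  have a1 := hA 0
  have a2 := hA (-1)
  have a3 := hA 2
  have d1 := hD 0
  have d3 := hD 2
  rcases hM with ((rfl | rfl | rfl | rfl | rfl | rfl) | ⟨α, rfl⟩) | ⟨α, rfl⟩ <;>
    rcases hN with ((rfl | rfl | rfl | rfl | rfl | rfl) | ⟨β, rfl⟩) | ⟨β, rfl⟩ <;>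
    first
    | exact Or.inl rfl
    | (exfalso
       clear hZ hA hD hpair
       have H := And.intro z1 (And.intro z2 (And.intro z3 (And.intro a1 (And.intro a2
        (And.intro a3 (And.intro d1 d3))))))
       clear z1 z2 z3 a1 a2 a3 d1 d3
       norm_num [pencil_A00_facts, pencil_A20_facts, pencil_A21_facts, pencil_A22_facts,
        pencil_A23_facts, pencil_A24_facts, pencil_A25_facts, pencil_A26_facts] at H <;>
       grind)
    | skip
  · exact absurd ((hA (-β)).2 ((pencil_A22_facts _ _).2.1.2 (by ring))) (pencil_A25_facts _).2.1
  · exact absurd ((hA (-α)).1 ((pencil_A22_facts _ _).2.1.2 (by ring))) (pencil_A25_facts _).2.1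
  · have h := (pencil_A22_facts _ _).2.1.1 ((hA (-α)).1 ((pencil_A22_facts _ _).2.1.2 (by ring)))
    rcases hpair α β (by linear_combination h) with rfl | ⟨h1, rfl⟩
    · exact Or.inl rfl
    · exact Or.inr (Or.inl ⟨α, h1, rfl, rfl⟩)
  · have h := (pencil_A24_facts _ _).2.2.1 ((hD (-α)).1 ((pencil_A24_facts _ _).2.2.2 (by ring)))
    have h' := (pencil_A24_facts _ _).2.2.1 ((hD (-β)).2 ((pencil_A24_facts _ _).2.2.2 (by ring)))
    -- Every `A24` pencil is also singular at t = 1, which could absorb the root −α or −β. If it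
    -- absorbs both, then α = β = −1.
    have h'' : (1 - α * β) * (β - α) = 0 := by
      rcases mul_eq_zero.1 h with h | h
      · linear_combination h
      · rcases mul_eq_zero.1 h' with h' | h'
        · linear_combination -h'
        · rw [show α = β by linear_combination h - h']; ring
    rcases hpair α β h'' with rfl | ⟨h1, rfl⟩
    · exact Or.inl rfl
    · exact Or.inr (Or.inr ⟨α, h1, rfl, rfl⟩)

end Kokoris

/-! ### Invariants separating the algebras of the list -/

section Invariants

variable (A : Type*) [NonUnitalNonAssocRing A]

/-- The product is anticommutative. -/
def IsAnti : Prop := ∀ x y : A, x * y = -(y * x)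

/-- The product is commutative. -/
def IsComm : Prop := ∀ x y : A, x * y = y * x

/-- All products `(x y) z` vanish. -/
def IsNilThree : Prop := ∀ x y z : A, x * y * z = 0

/-- There is a square-zero element which does not annihilate `A⁺`. -/
def HasNilNonAnn : Prop := ∃ x y : A, x * x = 0 ∧ x * y + y * x ≠ 0

/-- There is a nonzero idempotent. -/
def HasIdem : Prop := ∃ e : A, e ≠ 0 ∧ e * e = e

/-- There is a left unit. -/
def HasLeftUnit : Prop := ∃ u : A, ∀ x, u * x = x

/-- There is a nonzero idempotent which is not a left unit. -/
def HasProperIdem : Prop := ∃ e x : A, e ≠ 0 ∧ e * e = e ∧ e * x ≠ x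

/-- There is an element with nonzero square and zero cube. -/
def HasCubeZero : Prop := ∃ x : A, x * x ≠ 0 ∧ x * x * x = 0

/-- There are two nonzero idempotents with zero product. -/
def HasOrthIdem : Prop := ∃ e f : A, e ≠ 0 ∧ f ≠ 0 ∧ e * e = e ∧ f * f = f ∧ e * f = 0

/-- The commutator with some square-zero element is proportional to the anticommutator. -/
def HasCommRatio [Module ℂ A] (c : ℂ) : Prop :=
  ∃ x y : A, x * x = 0 ∧ x * y + y * x ≠ 0 ∧ x * y - y * x = c • (x * y + y * x)

variable {A} {B : Type*} [NonUnitalNonAssocRing B] [Module ℂ A] [Module ℂ B]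

theorem IsAnti.of_algIso (h : AlgIso A B) (hA : IsAnti A) : IsAnti B := by
  obtain ⟨f, hf⟩ := h
  intro x y
  obtain ⟨x, rfl⟩ := hf.2 x
  obtain ⟨y, rfl⟩ := hf.2 y
  rw [← map_mul, hA, map_neg, map_mul]

theorem IsComm.of_algIso (h : AlgIso A B) (hA : IsComm A) : IsComm B := by
  obtain ⟨f, hf⟩ := h
  intro x y
  obtain ⟨x, rfl⟩ := hf.2 x
  obtain ⟨y, rfl⟩ := hf.2 y
  rw [← map_mul, hA, map_mul]

theorem IsNilThree.of_algIso (h : AlgIso A B) (hA : IsNilThree A) : IsNilThree B := by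
  obtain ⟨f, hf⟩ := h
  intro x y z
  obtain ⟨x, rfl⟩ := hf.2 x
  obtain ⟨y, rfl⟩ := hf.2 y
  obtain ⟨z, rfl⟩ := hf.2 z
  rw [← map_mul, ← map_mul, hA, map_zero]

theorem HasNilNonAnn.of_algIso (h : AlgIso A B) (hA : HasNilNonAnn A) : HasNilNonAnn B := by
  obtain ⟨f, hf⟩ := h
  obtain ⟨x, y, h1, h2⟩ := hA
  refine ⟨f x, f y, by rw [← map_mul, h1, map_zero], ?_⟩
  rwa [← map_mul, ← map_mul, ← map_add, ne_eq, map_eq_zero_iff f hf.1]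

theorem HasIdem.of_algIso (h : AlgIso A B) (hA : HasIdem A) : HasIdem B := by
  obtain ⟨f, hf⟩ := h
  obtain ⟨e, h1, h2⟩ := hA
  exact ⟨f e, by rwa [ne_eq, map_eq_zero_iff f hf.1], by rw [← map_mul, h2]⟩

theorem HasLeftUnit.of_algIso (h : AlgIso A B) (hA : HasLeftUnit A) : HasLeftUnit B := by
  obtain ⟨f, hf⟩ := h
  obtain ⟨u, hu⟩ := hA
  refine ⟨f u, fun x => ?_⟩
  obtain ⟨x, rfl⟩ := hf.2 x
  rw [← map_mul, hu]

theorem HasProperIdem.of_algIso (h : AlgIso A B) (hA : HasProperIdem A) : HasProperIdem B := by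
  obtain ⟨f, hf⟩ := h
  obtain ⟨e, x, h1, h2, h3⟩ := hA
  exact ⟨f e, f x, by rwa [ne_eq, map_eq_zero_iff f hf.1], by rw [← map_mul, h2],
    by rwa [← map_mul, hf.1.ne_iff]⟩

theorem HasCubeZero.of_algIso (h : AlgIso A B) (hA : HasCubeZero A) : HasCubeZero B := by
  obtain ⟨f, hf⟩ := h
  obtain ⟨x, h1, h2⟩ := hA
  exact ⟨f x, by rwa [← map_mul, ne_eq, map_eq_zero_iff f hf.1],
    by rw [← map_mul, ← map_mul, h2, map_zero]⟩

theorem HasOrthIdem.of_algIso (h : AlgIso A B) (hA : HasOrthIdem A) : HasOrthIdem B := by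
  obtain ⟨f, hf⟩ := h
  obtain ⟨x, y, h1, h2, h3, h4, h5⟩ := hA
  exact ⟨f x, f y, by rwa [ne_eq, map_eq_zero_iff f hf.1], by rwa [ne_eq, map_eq_zero_iff f hf.1],
    by rw [← map_mul, h3], by rw [← map_mul, h4], by rw [← map_mul, h5, map_zero]⟩

theorem HasCommRatio.of_algIso {c : ℂ} (h : AlgIso A B) (hA : HasCommRatio A c) :
    HasCommRatio B c := by
  obtain ⟨f, hf⟩ := h
  obtain ⟨x, y, h1, h2, h3⟩ := hA
  refine ⟨f x, f y, by rw [← map_mul, h1, map_zero], ?_, ?_⟩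
  · rwa [← map_mul, ← map_mul, ← map_add, ne_eq, map_eq_zero_iff f hf.1]
  · rw [← map_mul, ← map_mul, ← map_add, ← map_sub, h3, map_smul]

end Invariants

namespace Kokoris

open Classical in
/-- A decision tree which separates the algebras of the list that are not anticommutative, up to
the parameter of `A02`. -/
noncomputable def kind (A : Type*) [NonUnitalNonAssocRing A] : ℕ :=
  if IsAnti A then 0
  else if IsNilThree A then
    if HasNilNonAnn A then 2 else if IsComm A then 1 else 28
  else if HasIdem A then
    if HasLeftUnit A then
      if IsComm A then
        if HasNilNonAnn A then
          if HasProperIdem A then 5 else if HasCubeZero A then 7 else 6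
        else 4
      else 29
    else
      if IsComm A then
        if HasNilNonAnn A then 9
        else if HasCubeZero A then 11
        else if HasOrthIdem A then 8
        else 10
      else 30
  else if IsComm A then 3 else 27

theorem kind_eq_of_algIso {A B : Type*} [NonUnitalNonAssocRing A] [NonUnitalNonAssocRing B]
    [Module ℂ A] [Module ℂ B] (h : AlgIso A B) : kind A = kind B := by
  rw [kind, kind,
    propext (⟨.of_algIso h, .of_algIso h.symm⟩ : IsAnti A ↔ IsAnti B),
    propext (⟨.of_algIso h, .of_algIso h.symm⟩ : IsComm A ↔ IsComm B),
    propext (⟨.of_algIso h, .of_algIso h.symm⟩ : IsNilThree A ↔ IsNilThree B),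
    propext (⟨.of_algIso h, .of_algIso h.symm⟩ : HasNilNonAnn A ↔ HasNilNonAnn B),
    propext (⟨.of_algIso h, .of_algIso h.symm⟩ : HasIdem A ↔ HasIdem B),
    propext (⟨.of_algIso h, .of_algIso h.symm⟩ : HasLeftUnit A ↔ HasLeftUnit B),
    propext (⟨.of_algIso h, .of_algIso h.symm⟩ : HasProperIdem A ↔ HasProperIdem B),
    propext (⟨.of_algIso h, .of_algIso h.symm⟩ : HasCubeZero A ↔ HasCubeZero B),
    propext (⟨.of_algIso h, .of_algIso h.symm⟩ : HasOrthIdem A ↔ HasOrthIdem B)]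

theorem alg_mul {N : Name} (x y : Alg N) :
    x * y = TableAlgebra.ofCoord (table N) (mulVec N x.coord y.coord) :=
  alg_mul_coord x y

/-! ### The invariants evaluated in coordinates on the list. -/

section Coordinates

variable (N : Name)

theorem isAnti_alg_iff : IsAnti (Alg N) ↔ ∀ x y, mulVec N x y = -mulVec N y x := by
  simp only [IsAnti, alg_mul]; exact Iff.rfl

theorem isComm_alg_iff : IsComm (Alg N) ↔ ∀ x y, mulVec N x y = mulVec N y x := by
  simp only [IsComm, alg_mul]; exact Iff.rfl

theorem isNilThree_alg_iff :
    IsNilThree (Alg N) ↔ ∀ x y z, mulVec N (mulVec N x y) z = 0 := by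
  simp only [IsNilThree, alg_mul]; exact Iff.rfl

theorem hasNilNonAnn_alg_iff : HasNilNonAnn (Alg N) ↔
    ∃ x y, mulVec N x x = 0 ∧ mulVec N x y + mulVec N y x ≠ 0 := by
  simp only [HasNilNonAnn, alg_mul]; exact Iff.rfl

theorem hasIdem_alg_iff : HasIdem (Alg N) ↔ ∃ e, e ≠ 0 ∧ mulVec N e e = e := by
  simp only [HasIdem, alg_mul]; exact Iff.rfl

theorem hasLeftUnit_alg_iff : HasLeftUnit (Alg N) ↔ ∃ u, ∀ x, mulVec N u x = x := by
  simp only [HasLeftUnit, alg_mul]; exact Iff.rfl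

theorem hasProperIdem_alg_iff : HasProperIdem (Alg N) ↔
    ∃ e x, e ≠ 0 ∧ mulVec N e e = e ∧ mulVec N e x ≠ x := by
  simp only [HasProperIdem, alg_mul]; exact Iff.rfl

theorem hasCubeZero_alg_iff : HasCubeZero (Alg N) ↔
    ∃ x, mulVec N x x ≠ 0 ∧ mulVec N (mulVec N x x) x = 0 := by
  simp only [HasCubeZero, alg_mul]; exact Iff.rfl

theorem hasOrthIdem_alg_iff : HasOrthIdem (Alg N) ↔ ∃ e f, e ≠ 0 ∧ f ≠ 0 ∧
    mulVec N e e = e ∧ mulVec N f f = f ∧ mulVec N e f = 0 := by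
  simp only [HasOrthIdem, alg_mul]; exact Iff.rfl

theorem hasCommRatio_alg_iff (c : ℂ) : HasCommRatio (Alg N) c ↔ ∃ x y, mulVec N x x = 0 ∧
    mulVec N x y + mulVec N y x ≠ 0 ∧
    mulVec N x y - mulVec N y x = c • (mulVec N x y + mulVec N y x) := by
  simp only [HasCommRatio, alg_mul]; exact Iff.rfl

end Coordinates

theorem isAnti_alg {N : Name} (hN : N ∈ anticommutativeList) : IsAnti (Alg N) := by
  rw [isAnti_alg_iff]
  intro x y
  cases N <;> simp [anticommutativeList] at hN <;>
    simp [funext_iff, Fin.forall_fin_succ, mulVec] <;> grind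

theorem not_isAnti_alg {N : Name} (hN : N ∉ anticommutativeList) : ¬ IsAnti (Alg N) := by
  rw [isAnti_alg_iff]
  intro h
  have h1 := h ![1, 0, 0] ![1, 0, 0]
  have h2 := h ![1, 0, 0] ![0, 1, 0]
  cases N <;> simp [anticommutativeList] at hN <;>
    simp [funext_iff, Fin.forall_fin_succ, mulVec] at h1 h2 <;> grind

theorem isComm_alg {N : Name} (hN : N ∈ commutativeList) : IsComm (Alg N) := by
  rw [isComm_alg_iff]
  intro x y
  cases N <;> simp [commutativeList] at hN <;>
    simp [funext_iff, Fin.forall_fin_succ, mulVec] <;> grind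

theorem not_isComm_alg {N : Name} (hN : N ∈ ({.A27, .A28, .A29, .A30} : Set Name)) :
    ¬ IsComm (Alg N) := by
  rw [isComm_alg_iff]
  intro h
  have h1 := h ![1, 0, 0] ![0, 0, 1]
  have h2 := h ![0, 1, 0] ![0, 0, 1]
  cases N <;> simp at hN <;>
    simp [funext_iff, Fin.forall_fin_succ, mulVec] at h1 h2 <;> grind

theorem isNilThree_alg {N : Name} (hN : N = .A01 ∨ (∃ α, N = .A02 α) ∨ N = .A28) :
    IsNilThree (Alg N) := by
  rw [isNilThree_alg_iff]
  rcases hN with rfl | ⟨α, rfl⟩ | rfl <;> simp [funext_iff, Fin.forall_fin_succ, mulVec]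

theorem not_isNilThree_alg {N : Name} (hN : N ∈ ({.A03, .A04, .A05, .A06, .A07, .A08, .A09, .A10,
    .A11, .A27, .A29, .A30} : Set Name)) : ¬ IsNilThree (Alg N) := by
  rw [isNilThree_alg_iff]
  intro h
  have h1 := h ![1, 0, 0] ![1, 0, 0] ![1, 0, 0]
  have h2 := h ![1, 0, 0] ![0, 0, 1] ![1, 0, 0]
  cases N <;> simp at hN <;> simp [funext_iff, Fin.forall_fin_succ, mulVec] at h1 h2

theorem hasNilNonAnn_alg {N : Name} (hN : (∃ α, N = .A02 α) ∨
    N ∈ ({.A05, .A06, .A07, .A09} : Set Name)) : HasNilNonAnn (Alg N) := by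
  rw [hasNilNonAnn_alg_iff]
  rcases hN with ⟨α, rfl⟩ | rfl | rfl | rfl | rfl
  · exact ⟨![1, 0, 0], ![0, 1, 0], by simp [funext_iff, Fin.forall_fin_succ, mulVec]⟩
  · exact ⟨![0, 0, 1], ![0, 1, 0], by simp [funext_iff, Fin.forall_fin_succ, mulVec]⟩
  · exact ⟨![0, 0, 1], ![1, 0, 0], by simp [funext_iff, Fin.forall_fin_succ, mulVec]⟩
  · exact ⟨![0, 0, 1], ![1, 0, 0], by simp [funext_iff, Fin.forall_fin_succ, mulVec]⟩
  · exact ⟨![0, 1, 0], ![1, 0, 0], by simp [funext_iff, Fin.forall_fin_succ, mulVec]⟩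

theorem not_hasNilNonAnn_alg {N : Name}
    (hN : N ∈ ({.A01, .A04, .A08, .A10, .A11, .A28} : Set Name)) : ¬ HasNilNonAnn (Alg N) := by
  rw [hasNilNonAnn_alg_iff]
  rintro ⟨x, y, h1, h2⟩
  rcases hN with rfl | rfl | rfl | rfl | rfl | rfl <;>
    simp [funext_iff, Fin.forall_fin_succ, mulVec] at h1 h2 <;> grind

theorem hasIdem_alg {N : Name} (hN : N ∈ ({.A04, .A05, .A06, .A07, .A08, .A09, .A10,
    .A11, .A29, .A30} : Set Name)) : HasIdem (Alg N) := by
  rw [hasIdem_alg_iff]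
  refine ⟨![1, 0, 0], by simp [funext_iff, Fin.forall_fin_succ], ?_⟩
  cases N <;> simp at hN <;> simp [mulVec]

theorem not_hasIdem_alg {N : Name} (hN : N = .A03 ∨ N = .A27) : ¬ HasIdem (Alg N) := by
  rw [hasIdem_alg_iff]
  rintro ⟨e, h1, h2⟩
  rcases hN with rfl | rfl <;>
    simp [funext_iff, Fin.forall_fin_succ, mulVec] at h1 h2 <;> grind

theorem hasLeftUnit_alg {N : Name} (hN : N ∈ ({.A04, .A05, .A06, .A07, .A29} : Set Name)) :
    HasLeftUnit (Alg N) := by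
  rw [hasLeftUnit_alg_iff]
  rcases hN with rfl | rfl | rfl | rfl | rfl
  · exact ⟨![1, 1, 1], by simp [funext_iff, Fin.forall_fin_succ, mulVec]⟩
  · exact ⟨![1, 1, 0], by simp [funext_iff, Fin.forall_fin_succ, mulVec]⟩
  all_goals exact ⟨![1, 0, 0], by simp [funext_iff, Fin.forall_fin_succ, mulVec]⟩

theorem not_hasLeftUnit_alg {N : Name} (hN : N ∈ ({.A08, .A09, .A10, .A11, .A30} : Set Name)) :
    ¬ HasLeftUnit (Alg N) := by
  rw [hasLeftUnit_alg_iff]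
  rintro ⟨u, h⟩
  have h1 := h ![0, 1, 0]
  have h2 := h ![0, 0, 1]
  rcases hN with rfl | rfl | rfl | rfl | rfl <;>
    simp [funext_iff, Fin.forall_fin_succ, mulVec] at h1 h2

theorem hasProperIdem_alg : HasProperIdem (Alg .A05) := by
  rw [hasProperIdem_alg_iff]
  exact ⟨![1, 0, 0], ![0, 1, 0], by simp [funext_iff, Fin.forall_fin_succ, mulVec]⟩

theorem not_hasProperIdem_alg {N : Name} (hN : N = .A06 ∨ N = .A07) :
    ¬ HasProperIdem (Alg N) := by
  rw [hasProperIdem_alg_iff]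
  rintro ⟨e, x, h1, h2, h3⟩
  rcases hN with rfl | rfl <;>
    simp [funext_iff, Fin.forall_fin_succ, mulVec] at h1 h2 h3 <;> grind

theorem hasCubeZero_alg {N : Name} (hN : N = .A07 ∨ N = .A11) : HasCubeZero (Alg N) := by
  rw [hasCubeZero_alg_iff]
  refine ⟨![0, 1, 0], ?_⟩
  rcases hN with rfl | rfl <;> simp [funext_iff, Fin.forall_fin_succ, mulVec]

theorem not_hasCubeZero_alg {N : Name} (hN : N = .A06 ∨ N = .A08 ∨ N = .A10) :
    ¬ HasCubeZero (Alg N) := by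
  rw [hasCubeZero_alg_iff]
  rintro ⟨x, h1, h2⟩
  rcases hN with rfl | rfl | rfl <;>
    simp [funext_iff, Fin.forall_fin_succ, mulVec] at h1 h2 <;> grind

theorem hasOrthIdem_alg : HasOrthIdem (Alg .A08) := by
  rw [hasOrthIdem_alg_iff]
  exact ⟨![1, 0, 0], ![0, 1, 0], by simp [funext_iff, Fin.forall_fin_succ, mulVec]⟩

theorem not_hasOrthIdem_alg : ¬ HasOrthIdem (Alg .A10) := by
  rw [hasOrthIdem_alg_iff]
  rintro ⟨e, f, h1, h2, h3, h4, h5⟩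
  simp [funext_iff, Fin.forall_fin_succ, mulVec] at h1 h2 h3 h4 h5
  grind

/-- A square-zero vector has first or second coordinate zero, and on each of these two planes the
ratio of commutator to anticommutator is constant, equal to α or −α. -/
theorem hasCommRatio_A02_iff (α c : ℂ) : HasCommRatio (Alg (.A02 α)) c ↔ c = α ∨ c = -α := by
  rw [hasCommRatio_alg_iff]
  constructor
  · rintro ⟨x, y, h1, h2, h3⟩
    simp [funext_iff, Fin.forall_fin_succ, mulVec] at h1 h2 h3
    have h4 : x 0 * x 1 = 0 := by linear_combination h1 / 2
    rcases mul_eq_zero.1 h4 with h | h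
    · simp only [h] at h2 h3
      refine Or.inr (mul_right_cancel₀ h2 ?_)
      linear_combination -h3
    · simp only [h] at h2 h3
      refine Or.inl (mul_right_cancel₀ h2 ?_)
      linear_combination -h3
  · rintro (rfl | rfl)
    · refine ⟨![1, 0, 0], ![0, 1, 0], ?_⟩
      simp [funext_iff, Fin.forall_fin_succ, mulVec]
      ring
    · refine ⟨![0, 1, 0], ![1, 0, 0], ?_⟩
      simp [funext_iff, Fin.forall_fin_succ, mulVec]
      ring

/-- The value of `kind` on the algebras of the list. -/
def kindCode : Name → ℕ
  | .A01 => 1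
  | .A02 _ => 2
  | .A03 => 3
  | .A04 => 4
  | .A05 => 5
  | .A06 => 6
  | .A07 => 7
  | .A08 => 8
  | .A09 => 9
  | .A10 => 10
  | .A11 => 11
  | .A27 => 27
  | .A28 => 28
  | .A29 => 29
  | .A30 => 30
  | _ => 0

theorem kind_alg (N : Name) : kind (Alg N) = kindCode N := by
  by_cases hN : N ∈ anticommutativeList
  · rw [kind, if_pos (isAnti_alg hN)]
    cases N <;> simp [anticommutativeList] at hN <;> rfl
  · rw [kind, if_neg (not_isAnti_alg hN)]
    cases N <;> simp [anticommutativeList] at hN <;>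
      simp [not_isComm_alg, isNilThree_alg, not_isNilThree_alg, hasNilNonAnn_alg,
        not_hasNilNonAnn_alg, hasIdem_alg, not_hasIdem_alg, hasLeftUnit_alg, not_hasLeftUnit_alg,
        hasProperIdem_alg, not_hasProperIdem_alg, hasCubeZero_alg, not_hasCubeZero_alg,
        hasOrthIdem_alg, not_hasOrthIdem_alg, kindCode]
    all_goals exact isComm_alg (by simp [commutativeList])

/-- Outside the anticommutative list the value of `kind` determines the name except for the
parameter of `A02`, which `HasCommRatio` recovers up to sign. -/
theorem algIso_alg_iff (M N : Name) : AlgIso (Alg M) (Alg N) ↔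
    M = N ∨
    (∃ α : ℂ, M = .A02 α ∧ N = .A02 (-α)) ∨
    (∃ α : ℂ, α ≠ 0 ∧ M = .A22 α ∧ N = .A22 α⁻¹) ∨
    (∃ α : ℂ, α ≠ 0 ∧ M = .A24 α ∧ N = .A24 α⁻¹) := by
  constructor
  · intro h
    have hk := kind_eq_of_algIso h
    rw [kind_alg, kind_alg] at hk
    by_cases hM : M ∈ anticommutativeList
    · have hN : N ∈ anticommutativeList := by
        by_contra hN
        exact not_isAnti_alg hN ((isAnti_alg hM).of_algIso h)
      exact (anticommutative_algIso hM hN h).imp_right Or.inr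
    · have hN : N ∉ anticommutativeList := fun hN =>
        not_isAnti_alg hM ((isAnti_alg hN).of_algIso h.symm)
      cases M with
      | A02 α =>
        cases N with
        | A02 β =>
          have h1 : HasCommRatio (Alg (.A02 β)) α :=
            .of_algIso h ((hasCommRatio_A02_iff α α).2 (Or.inl rfl))
          rcases (hasCommRatio_A02_iff β α).1 h1 with rfl | rfl
          · exact Or.inl rfl
          · exact Or.inr (Or.inl ⟨-β, rfl, by rw [neg_neg]⟩)
        | _ => simp [kindCode] at hk
      | _ =>
        left
        cases N <;> simp [kindCode, anticommutativeList] at hk hM hN <;> rfl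
  · rintro (rfl | ⟨α, rfl, rfl⟩ | ⟨α, hα, rfl, rfl⟩ | ⟨α, hα, rfl, rfl⟩)
    exacts [AlgIso.refl _, algIso_A02_neg α, algIso_A22_inv hα, algIso_A24_inv hα]

end Kokoris

theorem mainTheorem3 :
    -- every algebra in the list is a 3-dimensional Kokoris algebra
    (∀ N : Kokoris.Name, Module.finrank ℂ (Kokoris.Alg N) = 3 ∧ IsKokoris (Kokoris.Alg N)) ∧
    -- every 3-dimensional Kokoris algebra is in the list, up to isomorphism
    (∀ (K : Type*) [NonUnitalNonAssocRing K] [Module ℂ K] [IsScalarTower ℂ K K]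
        [SMulCommClass ℂ K K], Module.finrank ℂ K = 3 → IsKokoris K →
      (((∀ x y : K, x * y = y * x) ∧ (∀ x y z : K, (x * y) * z = x * (y * z)) ∧
          ∃ N ∈ Kokoris.commutativeList, AlgIso K (Kokoris.Alg N)) ∨
        ((∀ x y : K, x * y = -(y * x)) ∧
          ∃ N ∈ Kokoris.anticommutativeList, AlgIso K (Kokoris.Alg N)) ∨
        ∃ N ∈ Kokoris.properList, AlgIso K (Kokoris.Alg N))) ∧
    -- the only isomorphisms between algebras in the list
    (∀ M N : Kokoris.Name, AlgIso (Kokoris.Alg M) (Kokoris.Alg N) ↔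
      M = N ∨
      (∃ α : ℂ, M = .A02 α ∧ N = .A02 (-α)) ∨
      (∃ α : ℂ, α ≠ 0 ∧ M = .A22 α ∧ N = .A22 α⁻¹) ∨
      (∃ α : ℂ, α ≠ 0 ∧ M = .A24 α ∧ N = .A24 α⁻¹)) := by
  refine ⟨fun N => ⟨TableAlgebra.finrank_eq _, Kokoris.isKokoris_alg N⟩, ?_,
    Kokoris.algIso_alg_iff⟩
  intro K _ _ _ _ hfr hK
  exact Kokoris.isClassified hK hfr
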